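/- **Setting.** Let $A$ be an irreducible $k\times k$ matrix with non-negative integer entries. Take the directed graph with states $1,\dots,k$ and $A_{IJ}$ edges from $I$ to $J$. Let $X_A$ be the space of bi-infinite sequences $x=(x_i)_{i\in\mathbb Z}$ of edges such that $x_{i+1}$ starts at the state where $x_i$ ends, with the topology induced by the product topology over the discrete edge set, and let $\sigma_A$ be the shift, $(\sigma_A x)_i=x_{i+1}$. Assume that $(X_A,\sigma_A)$ has positive topological entropy. Let $\mathrm{Aut}(\sigma_A)$ be the group of homeomorphisms of $X_A$ commuting with $\sigma_A$. **Dimension triple.** Matrices act on row vectors. Put $R(A)=\mathbb Q^kA^k$, $\mathcal G_A=\{x\in R(A): xA^m\in\mathbb Z^k\text{ for some }m\ge 0\}$, $\mathcal G_A^+=\{x\in R(A): xA^m\in(\mathbb Z_{\ge0})^k\text{ for some }m\ge 0\}$ and $\delta_A(x)=xA$, an automorphism of $\mathcal G_A$. Let $\mathrm{Aut}(\mathcal G_A,\mathcal G_A^+,\delta_A)$ be the group of automorphisms of the group $\mathcal G_A$ that map $\mathcal G_A^+$ onto itself and commute with $\delta_A$. **Dimension representation.** An $m$-ray is a set $\{y\in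 X_A: y_i=x_i\text{ for all }i\le m\}$ with $x\in X_A$; an $m$-beam is a finite union of $m$-rays, and a beam is an $m$-beam for some $m\in\mathbb Z$. For an $m$-beam $U$ let $v_{U,m}\in\mathbb Z^k$ be the vector whose $J$-th entry is the number of distinct $m$-rays contained in $U$ whose $m$-th edge ends at $J$. Beams $U,V$ are equivalent if both are $m$-beams and $v_{U,m}=v_{V,m}$ for some $m$. The set $D_A^+$ of equivalence classes is an abelian semigroup under $[U]+[V]=[U'\cup V']$, where $U',V'$ are disjoint beams equivalent to $U,V$ respectively; let $D_A$ be its group completion. The map $\theta([U])=\delta_A^{-k-n}(v_{U,n}A^k)$, for an $n$-beam $U$, induces an isomorphism $\theta:D_A\to\mathcal G_A$ with $\theta(D_A^+)=\mathcal G_A^+$. Each $\phi\in\mathrm{Aut}(\sigma_A)$ induces an automorphism $\phi_*$ of $D_A$ by $\phi_*([U])=[\phi(U)]$. The dimension representation is the homomorphism $\pi_A:\mathrm{Aut}(\sigma_A)\to\mathrm{Aut}(\mathcal G_A,\mathcal G_A^+,\delta_A)$, $\pi_A(\phi)=\theta\circ\phi_*\circ\theta^{-1}$. An automorphism $\phi$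 is called inert if $\phi\in\ker\pi_A$. **Corollary 3.4.** Suppose in addition that the polynomial $\det(I-tA)\in\mathbb Q[t]$ is irreducible. If $\phi\in\mathrm{Aut}(\sigma_A)$ has topological entropy $h_{\mathrm{top}}(\phi)=0$, then $\phi$ is inert. -/

import Mathlib

namespace SFT

open Set Topology Filter

variable {k : ℕ} {A : Matrix (Fin k) (Fin k) ℕ}

/-- The edges of the directed graph with vertex set `Fin k` and `A i j` edges from `i` to `j`. -/
def Edge (A : Matrix (Fin k) (Fin k) ℕ) : Type := Σ i j : Fin k, Fin (A i j)

/-- The initial state of an edge. -/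
def Edge.src (e : Edge A) : Fin k := e.1

/-- The terminal state of an edge. -/
def Edge.tgt (e : Edge A) : Fin k := e.2.1

instance : Fintype (Edge A) :=
  @Sigma.instFintype (Fin k) (fun i => Σ j : Fin k, Fin (A i j)) (fun _ => inferInstance) _

/-- The alphabet of edges is discrete. -/
instance : UniformSpace (Edge A) := ⊥

instance : DiscreteUniformity (Edge A) := ⟨rfl⟩

/-- The edge shift `X_A`: bi-infinite walks, with the uniformity induced from the product
`(Edge A)^ℤ` of discrete spaces. -/
abbrev EdgeShift (A : Matrix (Fin k) (Fin k) ℕ) : Type :=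
  {x : ℤ → Edge A // ∀ i, (x i).tgt = (x (i + 1)).src}

/-- The shift map `σ_A`, `(σ_A x)_i = x_{i+1}`. -/
def shift (A : Matrix (Fin k) (Fin k) ℕ) : EdgeShift A ≃ₜ EdgeShift A where
  toFun x := ⟨fun i => x.1 (i + 1), fun i => x.2 (i + 1)⟩
  invFun x := ⟨fun i => x.1 (i - 1), fun i => by
    have h := x.2 (i - 1)
    rwa [show i - 1 + 1 = i + 1 - 1 by ring] at h⟩
  left_inv x := Subtype.ext (funext fun i => by simp)
  right_inv x := Subtype.ext (funext fun i => by simp)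
  continuous_toFun := by
    refine Continuous.subtype_mk ?_ _
    exact continuous_pi fun i => (continuous_apply (i + 1)).comp continuous_subtype_val
  continuous_invFun := by
    refine Continuous.subtype_mk ?_ _
    exact continuous_pi fun i => (continuous_apply (i - 1)).comp continuous_subtype_val

/-- `Aut(σ_A)`: the group (under composition) of homeomorphisms of `X_A` commuting with `σ_A`. -/
abbrev AutShift (A : Matrix (Fin k) (Fin k) ℕ) : Subgroup (EdgeShift A ≃ₜ EdgeShift A) :=
  Subgroup.centralizer {shift A}

/-- Topological entropy of a self-map of a compact space (Bowen's definition through the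
uniformity). -/
noncomputable def topEntropy {X : Type*} [UniformSpace X] (f : X → X) : EReal :=
  Dynamics.coverEntropy f univ

/-- The `m`-ray `R(x, m)`. -/
def ray (x : EdgeShift A) (m : ℤ) : Set (EdgeShift A) := {y | ∀ i ≤ m, y.1 i = x.1 i}

/-- An `m`-beam is a finite union of `m`-rays. -/
def IsBeam (U : Set (EdgeShift A)) (m : ℤ) : Prop :=
  ∃ s : Set (EdgeShift A), s.Finite ∧ U = ⋃ x ∈ s, ray x m

/-- The `m`-rays contained in the `m`-beam `U` whose last edge ends at the state `J`. -/
def endRays (U : Set (EdgeShift A)) (m : ℤ) (J : Fin k) : Set (Set (EdgeShift A)) :=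
  {R | ∃ x ∈ U, (x.1 m).tgt = J ∧ ray x m = R}

/-- The vector `v_{U,m}`: its `J`-th entry is the number of (distinct) `m`-rays of `U` that end
at `J`. -/
noncomputable def endCount (U : Set (EdgeShift A)) (m : ℤ) (J : Fin k) : ℕ :=
  (endRays U m J).ncard

lemma ray_eq_iff {x y : EdgeShift A} {m : ℤ} : ray x m = ray y m ↔ ∀ i ≤ m, x.1 i = y.1 i := by
  constructor
  · intro h
    have : x ∈ ray x m := fun i _ => rfl
    rw [h] at this
    exact this
  · intro h
    ext z
    exact ⟨fun hz i hi => (hz i hi).trans (h i hi), fun hz i hi => (hz i hi).trans (h i hi).symm⟩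

lemma exists_finite_reps {α β : Type*} {f : α → β} {U : Set α} (h : (f '' U).Finite) :
    ∃ t ⊆ U, t.Finite ∧ f '' t = f '' U := by
  rcases U.eq_empty_or_nonempty with rfl | ⟨u, -⟩
  · exact ⟨∅, subset_rfl, Set.finite_empty, rfl⟩
  have : Nonempty α := ⟨u⟩
  have key : ∀ b ∈ f '' U, ∃ a ∈ U, f a = b := fun b hb => hb
  choose! g hgU hg using key
  refine ⟨g '' (f '' U), ?_, h.image g, ?_⟩
  · rintro _ ⟨b, hb, rfl⟩; exact hgU b hb
  · ext b
    constructor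
    · rintro ⟨_, ⟨b', hb', rfl⟩, rfl⟩; rw [hg b' hb']; exact hb'
    · intro hb; exact ⟨g b, ⟨b, hb, rfl⟩, hg b hb⟩

lemma isBeam_iff {U : Set (EdgeShift A)} {m : ℤ} :
    IsBeam U m ↔ (∀ x ∈ U, ray x m ⊆ U) ∧ ((fun x => ray x m) '' U).Finite := by
  constructor
  · rintro ⟨s, hs, rfl⟩
    constructor
    · intro x hx y hy
      simp only [mem_iUnion] at hx ⊢
      obtain ⟨z, hz, hxz⟩ := hx
      exact ⟨z, hz, fun i hi => (hy i hi).trans (hxz i hi)⟩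
    · refine (hs.image (fun x => ray x m)).subset ?_
      rintro _ ⟨x, hx, rfl⟩
      simp only [mem_iUnion] at hx
      obtain ⟨z, hz, hxz⟩ := hx
      exact ⟨z, hz, ray_eq_iff.2 fun i hi => (hxz i hi).symm⟩
  · rintro ⟨h1, h2⟩
    obtain ⟨t, htU, ht, hte⟩ := exists_finite_reps h2
    refine ⟨t, ht, ?_⟩
    ext y
    simp only [mem_iUnion]
    constructor
    · intro hy
      have : ray y m ∈ (fun x => ray x m) '' t := by rw [hte]; exact ⟨y, hy, rfl⟩
      obtain ⟨x, hx, hxy⟩ := this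
      exact ⟨x, hx, ray_eq_iff.1 hxy.symm⟩
    · rintro ⟨x, hx, hxy⟩
      exact h1 x (htU hx) hxy

lemma endRays_finite {U : Set (EdgeShift A)} {m : ℤ} (h : IsBeam U m) (J : Fin k) :
    (endRays U m J).Finite :=
  (isBeam_iff.1 h).2.subset (by rintro _ ⟨x, hx, -, rfl⟩; exact ⟨x, hx, rfl⟩)

lemma IsBeam.succ {U : Set (EdgeShift A)} {m : ℤ} (h : IsBeam U m) : IsBeam U (m + 1) := by
  rw [isBeam_iff] at h ⊢
  refine ⟨fun x hx y hy => h.1 x hx fun i hi => hy i (by omega), ?_⟩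
  have hf : ((((fun x => ray x m) '' U) ×ˢ (univ : Set (Edge A)))).Finite :=
    h.2.prod (Set.toFinite _)
  have h3 : ((fun x : EdgeShift A => (ray x m, x.1 (m + 1))) '' U).Finite :=
    hf.subset (by rintro _ ⟨x, hx, rfl⟩; exact ⟨⟨x, hx, rfl⟩, trivial⟩)
  obtain ⟨t, htU, ht, hte⟩ := exists_finite_reps h3
  refine (ht.image (fun x => ray x (m + 1))).subset ?_
  rintro _ ⟨x, hx, rfl⟩
  have : (ray x m, x.1 (m + 1)) ∈ (fun x : EdgeShift A => (ray x m, x.1 (m + 1))) '' t := by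
    rw [hte]; exact ⟨x, hx, rfl⟩
  obtain ⟨y, hy, hxy⟩ := this
  simp only [Prod.mk.injEq] at hxy
  refine ⟨y, hy, ray_eq_iff.2 fun i hi => ?_⟩
  rcases eq_or_lt_of_le hi with rfl | hi
  · exact hxy.2
  · exact ray_eq_iff.1 hxy.1 i (by omega)

lemma IsBeam.mono {U : Set (EdgeShift A)} {m n : ℤ} (h : IsBeam U m) (hmn : m ≤ n) :
    IsBeam U n := by
  obtain ⟨d, rfl⟩ := Int.le.dest hmn
  induction d with
  | zero => simpa using h
  | succ d ih =>
    have := (ih (by omega)).succ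
    rwa [show m + d + 1 = m + ((d + 1 : ℕ) : ℤ) by push_cast; ring] at this

lemma IsBeam.union {U V : Set (EdgeShift A)} {m : ℤ} (hU : IsBeam U m) (hV : IsBeam V m) :
    IsBeam (U ∪ V) m := by
  obtain ⟨s, hs, rfl⟩ := hU
  obtain ⟨t, ht, rfl⟩ := hV
  exact ⟨s ∪ t, hs.union ht, by rw [biUnion_union]⟩

lemma endCount_union {U V : Set (EdgeShift A)} {m : ℤ} (hU : IsBeam U m) (hV : IsBeam V m)
    (hUV : Disjoint U V) (J : Fin k) :
    endCount (U ∪ V) m J = endCount U m J + endCount V m J := by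
  unfold endCount
  rw [← Set.ncard_union_eq _ (endRays_finite hU J) (endRays_finite hV J)]
  · congr 1
    ext R
    constructor
    · rintro ⟨x, hx | hx, h⟩
      · exact Or.inl ⟨x, hx, h⟩
      · exact Or.inr ⟨x, hx, h⟩
    · rintro (⟨x, hx, h⟩ | ⟨x, hx, h⟩)
      · exact ⟨x, Or.inl hx, h⟩
      · exact ⟨x, Or.inr hx, h⟩
  · rw [Set.disjoint_left]
    rintro R ⟨x, hx, -, rfl⟩ ⟨y, hy, -, hyR⟩
    refine Set.disjoint_left.1 hUV hx ((isBeam_iff.1 hV).1 y hy ?_)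
    exact ray_eq_iff.1 hyR.symm

/-- Follow `x` up to time `m` and `y` afterwards. -/
def splice (x y : EdgeShift A) (m : ℤ) (h : (x.1 m).tgt = (y.1 m).tgt) : EdgeShift A :=
  ⟨fun i => if i ≤ m then x.1 i else y.1 i, fun i => by
    beta_reduce
    rcases lt_trichotomy i m with hi | rfl | hi
    · rw [if_pos (by omega), if_pos (by omega)]; exact x.2 i
    · rw [if_pos le_rfl, if_neg (by omega), h]; exact y.2 i
    · rw [if_neg (by omega), if_neg (by omega)]; exact y.2 i⟩

lemma splice_le {x y : EdgeShift A} {m : ℤ} (h : (x.1 m).tgt = (y.1 m).tgt) {i : ℤ} (hi : i ≤ m) :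
    (splice x y m h).1 i = x.1 i := if_pos hi

lemma splice_gt {x y : EdgeShift A} {m : ℤ} (h : (x.1 m).tgt = (y.1 m).tgt) {i : ℤ} (hi : m < i) :
    (splice x y m h).1 i = y.1 i := if_neg (by omega)

lemma endCount_le_of_rel {U V : Set (EdgeShift A)} {n n' : ℤ} {J : Fin k} (hV : IsBeam V n')
    (r : EdgeShift A → EdgeShift A → Prop) (hr : ∀ y ∈ U, ∃ z ∈ V, r y z)
    (h1 : ∀ y ∈ U, ∀ z ∈ V, r y z → (y.1 n).tgt = (z.1 n').tgt)
    (h2 : ∀ y ∈ U, ∀ y' ∈ U, ∀ z ∈ V, ∀ z' ∈ V, r y z → r y' z' →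
      ray z n' = ray z' n' → ray y n = ray y' n) :
    endCount U n J ≤ endCount V n' J := by
  choose! f hfV hf using hr
  have key : ∀ R ∈ endRays U n J, ∃ x ∈ U, (x.1 n).tgt = J ∧ ray x n = R := fun R hR => hR
  have hne : endRays U n J = ∅ ∨ Nonempty (EdgeShift A) := by
    rcases (endRays U n J).eq_empty_or_nonempty with h | ⟨_, x, _⟩
    · exact Or.inl h
    · exact Or.inr ⟨x⟩
  rcases hne with hne | hne
  · simp [endCount, hne]
  choose! g hgU hgJ hg using key
  refine Set.ncard_le_ncard_of_injOn (fun R => ray (f (g R)) n') ?_ ?_ (endRays_finite hV J)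
  · intro R hR
    exact ⟨f (g R), hfV _ (hgU R hR),
      (h1 _ (hgU R hR) _ (hfV _ (hgU R hR)) (hf _ (hgU R hR))).symm.trans (hgJ R hR), rfl⟩
  · intro R hR R' hR' h
    rw [← hg R hR, ← hg R' hR']
    exact h2 _ (hgU R hR) _ (hgU R' hR') _ (hfV _ (hgU R hR)) _ (hfV _ (hgU R' hR'))
      (hf _ (hgU R hR)) (hf _ (hgU R' hR')) h

lemma endCount_eq_of_rel {U V : Set (EdgeShift A)} {n n' : ℤ} {J : Fin k} (hU : IsBeam U n)
    (hV : IsBeam V n') (r : EdgeShift A → EdgeShift A → Prop) (hr : ∀ y ∈ U, ∃ z ∈ V, r y z)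
    (hr' : ∀ z ∈ V, ∃ y ∈ U, r y z)
    (h1 : ∀ y ∈ U, ∀ z ∈ V, r y z → (y.1 n).tgt = (z.1 n').tgt)
    (h2 : ∀ y ∈ U, ∀ y' ∈ U, ∀ z ∈ V, ∀ z' ∈ V, r y z → r y' z' →
      (ray y n = ray y' n ↔ ray z n' = ray z' n')) :
    endCount U n J = endCount V n' J := by
  apply le_antisymm
  · exact endCount_le_of_rel hV r hr h1
      fun y hy y' hy' z hz z' hz' a b => (h2 y hy y' hy' z hz z' hz' a b).2
  · exact endCount_le_of_rel hU (fun z y => r y z) hr' (fun z hz y hy a => (h1 y hy z hz a).symm)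
      fun z hz z' hz' y hy y' hy' a b => (h2 y hy y' hy' z hz z' hz' a b).1

instance : CompactSpace (EdgeShift A) := by
  refine isCompact_iff_compactSpace.mp (?_ : IsCompact {x : ℤ → Edge A | ∀ i, (x i).tgt = (x (i + 1)).src})
  apply IsClosed.isCompact
  rw [show {x : ℤ → Edge A | ∀ i, (x i).tgt = (x (i + 1)).src} =
    ⋂ i, {x : ℤ → Edge A | (x i).tgt = (x (i + 1)).src} by ext; simp]
  refine isClosed_iInter fun i => isClosed_eq ?_ ?_
  · exact (continuous_of_discreteTopology (f := Edge.tgt (A := A))).comp (continuous_apply i)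
  · exact (continuous_of_discreteTopology (f := Edge.src (A := A))).comp (continuous_apply (i + 1))

lemma exists_window (f : EdgeShift A → EdgeShift A) (hf : Continuous f) :
    ∃ N : ℕ, ∀ x y : EdgeShift A, (∀ i : ℤ, -N ≤ i → i ≤ N → x.1 i = y.1 i) →
      (f x).1 0 = (f y).1 0 := by
  have hg : Continuous fun x => (f x).1 0 := (continuous_apply 0).comp
    (continuous_subtype_val.comp hf)
  have hcyl : ∀ (x : EdgeShift A) (N : ℕ),
      IsOpen {y : EdgeShift A | ∀ i ∈ Set.Icc (-N : ℤ) N, y.1 i = x.1 i} := by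
    intro x N
    have : {y : EdgeShift A | ∀ i ∈ Set.Icc (-N : ℤ) N, y.1 i = x.1 i} =
        ⋂ i ∈ Set.Icc (-N : ℤ) N, (fun y : EdgeShift A => y.1 i) ⁻¹' {x.1 i} := by
      ext y; simp
    rw [this]
    refine (Set.finite_Icc _ _).isOpen_biInter fun i _ => ?_
    exact (isOpen_discrete _).preimage ((continuous_apply i).comp continuous_subtype_val)
  have hloc : ∀ x : EdgeShift A, ∃ N : ℕ, ∀ y : EdgeShift A,
      (∀ i ∈ Set.Icc (-N : ℤ) N, y.1 i = x.1 i) → (f y).1 0 = (f x).1 0 := by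
    intro x
    have ho : IsOpen ((fun x => (f x).1 0) ⁻¹' {(f x).1 0}) := (isOpen_discrete _).preimage hg
    obtain ⟨W, hW, hWe⟩ := isOpen_induced_iff.1 ho
    have hxW : x.1 ∈ W := by
      have : x ∈ Subtype.val ⁻¹' W := by rw [hWe]; rfl
      exact this
    obtain ⟨I, u, hu, huW⟩ := isOpen_pi_iff.1 hW x.1 hxW
    refine ⟨I.sup Int.natAbs, fun y hy => ?_⟩
    have : y ∈ Subtype.val ⁻¹' W := by
      refine huW fun i hi => ?_
      have hle : i.natAbs ≤ I.sup Int.natAbs := Finset.le_sup (f := Int.natAbs) hi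
      rw [hy i ⟨by omega, by omega⟩]
      exact (hu i hi).2
    rw [hWe] at this
    exact this
  choose N hN using hloc
  obtain ⟨t, ht⟩ := isCompact_univ.elim_finite_subcover
    (fun x : EdgeShift A => {y : EdgeShift A | ∀ i ∈ Set.Icc (-(N x : ℤ)) (N x), y.1 i = x.1 i})
    (fun x => hcyl x (N x)) (fun x _ => mem_iUnion.2 ⟨x, fun i _ => rfl⟩)
  refine ⟨t.sup N, fun x y hxy => ?_⟩
  have hx := ht (mem_univ x)
  simp only [mem_iUnion] at hx
  obtain ⟨z, hz, hxz⟩ := hx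
  have hle : N z ≤ t.sup N := Finset.le_sup hz
  rw [hN z x hxz, hN z y]
  intro i hi
  rw [← hxz i hi, hxy i (by have := hi.1; omega) (by have := hi.2; omega)]

lemma shift_zpow_apply (n : ℤ) (x : EdgeShift A) (i : ℤ) :
    ((shift A ^ n) x).1 i = x.1 (i + n) := by
  induction n generalizing x i with
  | zero => simp
  | succ n ih =>
    rw [zpow_add_one, Homeomorph.mul_apply, ih]
    change x.1 (i + n + 1) = _
    rw [add_assoc]
  | pred n ih =>
    rw [zpow_sub_one, Homeomorph.mul_apply, ih]
    change x.1 (i + -n - 1) = _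
    rw [add_sub_assoc]

lemma AutShift.exists_window (φ : AutShift A) : ∃ N : ℕ, ∀ (x y : EdgeShift A) (m : ℤ),
    (∀ i : ℤ, m - N ≤ i → i ≤ m + N → x.1 i = y.1 i) → (φ.1 x).1 m = (φ.1 y).1 m := by
  obtain ⟨N, hN⟩ := SFT.exists_window φ.1 φ.1.continuous
  have hc : ∀ (n : ℤ), (shift A ^ n) * φ.1 = φ.1 * (shift A ^ n) := by
    intro n
    have := Subgroup.mem_centralizer_singleton_iff.1 φ.2
    exact ((show Commute φ.1 (shift A) from this).zpow_right n).symm.eq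
  have hc' : ∀ n x, (φ.1 x).1 n = (φ.1 ((shift A ^ n) x)).1 0 := by
    intro n x
    rw [← Homeomorph.mul_apply, ← hc, Homeomorph.mul_apply, shift_zpow_apply, zero_add]
  refine ⟨N, fun x y m h => ?_⟩
  rw [hc', hc' m y]
  refine hN _ _ fun i h1 h2 => ?_
  rw [shift_zpow_apply, shift_zpow_apply]
  exact h _ (by omega) (by omega)

/-- A common coding range of `φ` and `φ⁻¹`. -/
lemma AutShift.exists_window₂ (φ : AutShift A) : ∃ N : ℕ, (∀ (x y : EdgeShift A) (m : ℤ),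
    (∀ i : ℤ, m - N ≤ i → i ≤ m + N → x.1 i = y.1 i) → (φ.1 x).1 m = (φ.1 y).1 m) ∧
    (∀ (x y : EdgeShift A) (m : ℤ),
    (∀ i : ℤ, m - N ≤ i → i ≤ m + N → (φ.1 x).1 i = (φ.1 y).1 i) → x.1 m = y.1 m) := by
  obtain ⟨N, hN⟩ := AutShift.exists_window φ
  obtain ⟨M, hM⟩ := AutShift.exists_window φ⁻¹
  refine ⟨max N M, fun x y m h => hN x y m fun i h1 h2 => h i (by omega) (by omega),
    fun x y m h => ?_⟩
  have := hM (φ.1 x) (φ.1 y) m fun i h1 h2 => h i (by omega) (by omega)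
  simpa using this

lemma IsBeam.image_aut (φ : AutShift A) {N : ℕ}
    (hN : ∀ (x y : EdgeShift A) (m : ℤ),
    (∀ i : ℤ, m - N ≤ i → i ≤ m + N → x.1 i = y.1 i) → (φ.1 x).1 m = (φ.1 y).1 m)
    (hN' : ∀ (x y : EdgeShift A) (m : ℤ),
    (∀ i : ℤ, m - N ≤ i → i ≤ m + N → (φ.1 x).1 i = (φ.1 y).1 i) → x.1 m = y.1 m)
    {U : Set (EdgeShift A)} {m : ℤ} (hU : IsBeam U m) : IsBeam (φ.1 '' U) (m + N) := by
  rw [isBeam_iff]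
  constructor
  · rintro _ ⟨x, hx, rfl⟩ z hz
    obtain ⟨y, rfl⟩ := φ.1.surjective z
    refine ⟨y, (isBeam_iff.1 hU).1 x hx fun i hi => ?_, rfl⟩
    exact hN' _ _ _ fun j _ h2 => hz j (by omega)
  · have h := (isBeam_iff.1 (hU.mono (show m ≤ m + N + N by omega))).2
    obtain ⟨t, htU, ht, hte⟩ := exists_finite_reps h
    refine (ht.image (fun x => ray (φ.1 x) (m + N))).subset ?_
    rintro _ ⟨_, ⟨x, hx, rfl⟩, rfl⟩
    have : ray x (m + N + N) ∈ (fun x => ray x (m + N + N)) '' t := by rw [hte]; exact ⟨x, hx, rfl⟩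
    obtain ⟨y, hy, hxy⟩ := this
    refine ⟨y, hy, ray_eq_iff.2 fun i hi => hN _ _ _ fun j _ h2 => ?_⟩
    exact ray_eq_iff.1 hxy j (by omega)

lemma endCount_image_aut (φ : AutShift A) {N : ℕ}
    (hN : ∀ (x y : EdgeShift A) (m : ℤ),
    (∀ i : ℤ, m - N ≤ i → i ≤ m + N → x.1 i = y.1 i) → (φ.1 x).1 m = (φ.1 y).1 m)
    (hN' : ∀ (x y : EdgeShift A) (m : ℤ),
    (∀ i : ℤ, m - N ≤ i → i ≤ m + N → (φ.1 x).1 i = (φ.1 y).1 i) → x.1 m = y.1 m)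
    {U V : Set (EdgeShift A)} {m : ℤ} (hU : IsBeam U m) (hV : IsBeam V m)
    (h : endCount U m = endCount V m) :
    endCount (φ.1 '' U) (m + N + N + N + 1) = endCount (φ.1 '' V) (m + N + N + N + 1) := by
  have hb : ∀ J, Nonempty (endRays U m J ≃ endRays V m J) := fun J => by
    have := (endRays_finite hU J).to_subtype
    have := (endRays_finite hV J).to_subtype
    have h' := congrFun h J
    unfold endCount at h'
    exact Finite.card_eq.1 (by simpa only [Nat.card_coe_set_eq] using h')
  have e : ∀ J, endRays U m J ≃ endRays V m J := fun J => (hb J).some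
  -- matching points of `U` and `V`
  let r : EdgeShift A → EdgeShift A → Prop := fun y z =>
    (∃ J, ∃ hy : ray y m ∈ endRays U m J, (e J ⟨ray y m, hy⟩).1 = ray z m) ∧
      ∀ i, m < i → y.1 i = z.1 i
  have hmem : ∀ {W : Set (EdgeShift A)} {y : EdgeShift A} {J},
      ray y m ∈ endRays W m J → (y.1 m).tgt = J := by
    rintro W y J ⟨x, _, hx, hxy⟩
    rw [← hx, ray_eq_iff.1 hxy m le_rfl]
  have hr : ∀ y ∈ U, ∃ z ∈ V, r y z := by
    intro y hy
    have hyR : ray y m ∈ endRays U m (y.1 m).tgt := ⟨y, hy, rfl, rfl⟩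
    obtain ⟨x, hx, hxJ, hxR⟩ := (e _ ⟨_, hyR⟩).2
    have hsp : ray (splice x y m hxJ) m = ray x m := ray_eq_iff.2 fun i hi => splice_le hxJ hi
    refine ⟨splice x y m hxJ, (isBeam_iff.1 hV).1 x hx fun i hi => splice_le hxJ hi,
      ⟨_, hyR, ?_⟩, fun i hi => (splice_gt hxJ hi).symm⟩
    rw [hsp, hxR]
  have hr' : ∀ z ∈ V, ∃ y ∈ U, r y z := by
    intro z hz
    have hzR : ray z m ∈ endRays V m (z.1 m).tgt := ⟨z, hz, rfl, rfl⟩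
    obtain ⟨x, hx, hxJ, hxR⟩ := ((e _).symm ⟨_, hzR⟩).2
    have hsp : ray (splice x z m hxJ) m = ray x m := ray_eq_iff.2 fun i hi => splice_le hxJ hi
    refine ⟨splice x z m hxJ, (isBeam_iff.1 hU).1 x hx fun i hi => splice_le hxJ hi,
      ⟨(z.1 m).tgt, ?_, ?_⟩, fun i hi => (splice_gt hxJ hi)⟩
    · rw [hsp]; exact ⟨x, hx, hxJ, rfl⟩
    · simp only [hsp, hxR, Subtype.coe_eta, Equiv.apply_symm_apply]
  have hpast : ∀ y z y' z', r y z → r y' z' → (ray y m = ray y' m ↔ ray z m = ray z' m) := by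
    rintro y z y' z' ⟨⟨J, h1, h2⟩, -⟩ ⟨⟨J', h1', h2'⟩, -⟩
    rw [← h2, ← h2']
    constructor
    · intro hyy
      obtain rfl : J = J' := by rw [← hmem h1, ← hmem h1', ray_eq_iff.1 hyy m le_rfl]
      simp only [hyy]
    · intro hzz
      have hz : ray z m ∈ endRays V m J := h2 ▸ (e J ⟨_, h1⟩).2
      have hz' : ray z' m ∈ endRays V m J' := h2' ▸ (e J' ⟨_, h1'⟩).2
      have hzz' : ray z m = ray z' m := by rw [← h2, ← h2', hzz]
      obtain rfl : J = J' := by rw [← hmem hz, ← hmem hz', ray_eq_iff.1 hzz' m le_rfl]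
      exact congrArg Subtype.val ((e J).injective (Subtype.ext hzz))
  have hagree : ∀ n, m ≤ n → ∀ y z y' z', r y z → r y' z' →
      (ray y n = ray y' n ↔ ray z n = ray z' n) := by
    intro n hn y z y' z' h1 h2
    have hp := hpast y z y' z' h1 h2
    simp only [ray_eq_iff] at hp ⊢
    constructor
    · intro h3 i hi
      by_cases him : i ≤ m
      · exact hp.1 (fun j hj => h3 j (by omega)) i him
      · rw [← h1.2 i (by omega), ← h2.2 i (by omega), h3 i hi]
    · intro h3 i hi
      by_cases him : i ≤ m
      · exact hp.2 (fun j hj => h3 j (by omega)) i him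
      · rw [h1.2 i (by omega), h2.2 i (by omega), h3 i hi]
  have htail : ∀ y z, r y z → ∀ i, m + N < i → (φ.1 y).1 i = (φ.1 z).1 i :=
    fun y z hyz i hi => hN _ _ _ fun j h1 _ => hyz.2 j (by omega)
  have hdown : ∀ y y' n, ray (φ.1 y) (n + N) = ray (φ.1 y') (n + N) → ray y n = ray y' n := by
    intro y y' n hyy
    refine ray_eq_iff.2 fun i hi => hN' _ _ _ fun j _ hj => ray_eq_iff.1 hyy j (by omega)
  have hup : ∀ y y' n, ray y (n + N) = ray y' (n + N) → ray (φ.1 y) n = ray (φ.1 y') n := by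
    intro y y' n hyy
    refine ray_eq_iff.2 fun i hi => hN _ _ _ fun j _ hj => ray_eq_iff.1 hyy j (by omega)
  funext J
  refine endCount_eq_of_rel ((hU.image_aut φ hN hN').mono (by omega))
    ((hV.image_aut φ hN hN').mono (by omega))
    (fun y z => ∃ y₀ z₀, φ.1 y₀ = y ∧ φ.1 z₀ = z ∧ r y₀ z₀) ?_ ?_ ?_ ?_
  · rintro _ ⟨y, hy, rfl⟩
    obtain ⟨z, hz, hyz⟩ := hr y hy
    exact ⟨_, ⟨z, hz, rfl⟩, y, z, rfl, rfl, hyz⟩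
  · rintro _ ⟨z, hz, rfl⟩
    obtain ⟨y, hy, hyz⟩ := hr' z hz
    exact ⟨_, ⟨y, hy, rfl⟩, y, z, rfl, rfl, hyz⟩
  · rintro _ - _ - ⟨y, z, rfl, rfl, hyz⟩
    rw [htail y z hyz _ (by omega)]
  · rintro _ - _ - _ - _ - ⟨y, z, rfl, rfl, hyz⟩ ⟨y', z', rfl, rfl, hyz'⟩
    have e1 : m + N + N + N + 1 = m + N + N + 1 + N := by ring
    have e2 : m + N + N + 1 = m + N + 1 + N := by ring
    constructor
    · intro h3
      have h4 : ray (φ.1 z) (m + N + 1) = ray (φ.1 z') (m + N + 1) := by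
        apply hup
        rw [← e2, ← hagree _ (by omega) y z y' z' hyz hyz']
        apply hdown
        rw [← e1]; exact h3
      refine ray_eq_iff.2 fun i hi => ?_
      by_cases him : i ≤ m + N
      · exact ray_eq_iff.1 h4 i (by omega)
      · rw [← htail y z hyz i (by omega), ← htail y' z' hyz' i (by omega), ray_eq_iff.1 h3 i hi]
    · intro h3
      have h4 : ray (φ.1 y) (m + N + 1) = ray (φ.1 y') (m + N + 1) := by
        apply hup
        rw [← e2, hagree _ (by omega) y z y' z' hyz hyz']
        apply hdown
        rw [← e1]; exact h3
      refine ray_eq_iff.2 fun i hi => ?_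
      by_cases him : i ≤ m + N
      · exact ray_eq_iff.1 h4 i (by omega)
      · rw [htail y z hyz i (by omega), htail y' z' hyz' i (by omega), ray_eq_iff.1 h3 i hi]

/-- The standing assumptions: `A` is irreducible and `(X_A, σ_A)` has positive entropy. -/
structure PosIrreducible (A : Matrix (Fin k) (Fin k) ℕ) : Prop where
  irreducible : (A.map (Nat.cast : ℕ → ℤ)).IsIrreducible
  entropy_pos : 0 < topEntropy (shift A)

lemma PosIrreducible.exists_pow_pos (h : PosIrreducible A) (i j : Fin k) :
    ∃ t > 0, 0 < (A ^ t) i j := by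
  obtain ⟨t, ht, hp⟩ := (Matrix.isIrreducible_iff_exists_pow_pos
    (fun i j => by simp)).1 h.irreducible i j
  refine ⟨t, ht, ?_⟩
  have e : (A.map (Nat.cast : ℕ → ℤ)) ^ t = (A ^ t).map (Nat.cast : ℕ → ℤ) :=
    (map_pow (Nat.castRingHom ℤ).mapMatrix A t).symm
  rw [e] at hp
  simpa using hp

lemma exists_edge {i j : Fin k} (h : 0 < A i j) : ∃ e : Edge A, e.src = i ∧ e.tgt = j :=
  ⟨⟨i, j, ⟨0, h⟩⟩, rfl, rfl⟩

lemma PosIrreducible.exists_next (h : PosIrreducible A) (i : Fin k) :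
    ∃ e : Edge A, e.src = i := by
  obtain ⟨t, ht, hp⟩ := h.exists_pow_pos i i
  obtain ⟨s, rfl⟩ : ∃ s, t = s + 1 := ⟨t - 1, by omega⟩
  rw [pow_succ', Matrix.mul_apply] at hp
  obtain ⟨l, -, hl⟩ := Finset.exists_ne_zero_of_sum_ne_zero hp.ne'
  obtain ⟨e, he, -⟩ := exists_edge (A := A) (i := i) (j := l)
    (Nat.pos_of_ne_zero (left_ne_zero_of_mul hl))
  exact ⟨e, he⟩

/-- Every walk up to time `m` can be continued by any edge that may follow. -/
lemma PosIrreducible.exists_extension (h : PosIrreducible A) (x : EdgeShift A) (m : ℤ)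
    (e : Edge A) (he : e.src = (x.1 m).tgt) :
    ∃ y : EdgeShift A, y ∈ ray x m ∧ y.1 (m + 1) = e := by
  have hn : ∀ e : Edge A, ∃ e' : Edge A, e'.src = e.tgt := fun e => h.exists_next e.tgt
  choose nx hnx using hn
  refine ⟨⟨fun i => if i ≤ m then x.1 i else nx^[(i - m - 1).toNat] e, fun i => ?_⟩,
    fun i hi => if_pos hi, ?_⟩
  · beta_reduce
    rcases lt_trichotomy i m with hi | rfl | hi
    · rw [if_pos (by omega), if_pos (by omega)]; exact x.2 i
    · rw [if_pos le_rfl, if_neg (by omega), ← he]; simp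
    · rw [if_neg (by omega), if_neg (by omega),
        show (i + 1 - m - 1).toNat = (i - m - 1).toNat + 1 by omega,
        Function.iterate_succ_apply', hnx]
  · change (if m + 1 ≤ m then _ else _) = e
    rw [if_neg (by omega)]
    simp

/-- Sends an `(m+1)`-ray to the `m`-ray containing it. -/
def coarsen (m : ℤ) (R : Set (EdgeShift A)) : Set (EdgeShift A) := ⋃ x ∈ R, ray x m

lemma coarsen_ray (x : EdgeShift A) (m : ℤ) : coarsen m (ray x (m + 1)) = ray x m := by
  ext z
  simp only [coarsen, mem_iUnion]
  constructor
  · rintro ⟨y, hy, hz⟩ i hi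
    rw [hz i hi, hy i (by omega)]
  · exact fun hz => ⟨x, fun _ _ => rfl, hz⟩

lemma PosIrreducible.endCount_succ (h : PosIrreducible A) {U : Set (EdgeShift A)} {m : ℤ}
    (hU : IsBeam U m) : endCount U (m + 1) = Matrix.vecMul (endCount U m) A := by
  classical
  funext J
  let T : Edge A → Set (Set (EdgeShift A)) := fun e =>
    {R | ∃ x ∈ U, x.1 (m + 1) = e ∧ e.tgt = J ∧ ray x (m + 1) = R}
  have hT : endRays U (m + 1) J = ⋃ e, T e := by
    ext R
    simp only [mem_iUnion]
    constructor
    · rintro ⟨x, hx, hJ, hR⟩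
      exact ⟨_, x, hx, rfl, hJ, hR⟩
    · rintro ⟨_, x, hx, rfl, hJ, hR⟩
      exact ⟨x, hx, hJ, hR⟩
  have hsub : ∀ e, T e ⊆ endRays U (m + 1) J := fun e => hT ▸ subset_iUnion T e
  have hfin : ∀ e, (T e).Finite := fun e => (endRays_finite hU.succ J).subset (hsub e)
  have hdisj : Pairwise (Function.onFun Disjoint T) := by
    intro e e' hee
    rw [Function.onFun, Set.disjoint_left]
    rintro R ⟨x, -, hx, -, rfl⟩ ⟨x', -, hx', -, hR⟩
    exact hee (by rw [← hx, ← hx', ray_eq_iff.1 hR (m + 1) le_rfl])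
  have hcard : ∀ e, (T e).ncard = if e.tgt = J then endCount U m e.src else 0 := by
    intro e
    split_ifs with hJ
    · have hinj : Set.InjOn (coarsen m) (T e) := by
        rintro _ ⟨x, hx, hxe, -, rfl⟩ _ ⟨y, hy, hye, -, rfl⟩ hxy
        rw [coarsen_ray, coarsen_ray, ray_eq_iff] at hxy
        refine ray_eq_iff.2 fun i hi => ?_
        rcases eq_or_lt_of_le hi with rfl | hi
        · rw [hxe, hye]
        · exact hxy i (by omega)
      rw [← hinj.ncard_image, endCount]
      congr 1
      ext R
      constructor
      · rintro ⟨_, ⟨x, hx, rfl, -, rfl⟩, rfl⟩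
        exact ⟨x, hx, x.2 m, (coarsen_ray x m).symm⟩
      · rintro ⟨x, hx, hxe, rfl⟩
        obtain ⟨y, hy, hye⟩ := h.exists_extension x m e hxe.symm
        refine ⟨_, ⟨y, (isBeam_iff.1 hU).1 x hx hy, hye, hJ, rfl⟩, ?_⟩
        rw [coarsen_ray]
        exact ray_eq_iff.2 hy
    · have : T e = ∅ := by
        ext R
        simp only [mem_empty_iff_false, iff_false]
        rintro ⟨x, -, -, hJ', -⟩
        exact hJ hJ'
      rw [this, Set.ncard_empty]
  rw [endCount, hT, Set.ncard_iUnion_of_finite hfin hdisj, finsum_eq_sum_of_fintype]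
  simp only [hcard]
  have hs : ∀ F : Edge A → ℕ, ∑ e, F e = ∑ i, ∑ j, ∑ a : Fin (A i j), F ⟨i, j, a⟩ := by
    intro F
    let _ : ∀ i, Fintype (Σ j : Fin k, Fin (A i j)) := fun _ => inferInstance
    refine (Fintype.sum_sigma (α := fun i => Σ j : Fin k, Fin (A i j)) F).trans ?_
    exact Finset.sum_congr rfl fun i _ => Fintype.sum_sigma _
  rw [hs]
  simp only [Matrix.vecMul, dotProduct]
  refine Finset.sum_congr rfl fun i _ => ?_
  rw [Finset.sum_eq_single J]
  · simp [Edge.tgt, Edge.src, mul_comm]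
  · intro j _ hj
    simp [Edge.tgt, hj]
  · simp

lemma PosIrreducible.endCount_add (h : PosIrreducible A) {U : Set (EdgeShift A)} {m : ℤ}
    (hU : IsBeam U m) (t : ℕ) : endCount U (m + t) = Matrix.vecMul (endCount U m) (A ^ t) := by
  induction t with
  | zero => simp
  | succ t ih =>
    rw [pow_succ, ← Matrix.vecMul_vecMul, ← ih, ← h.endCount_succ (hU.mono (by omega))]
    congr 1; push_cast; ring

lemma image_zpow_ray (n : ℤ) (x : EdgeShift A) (m : ℤ) :
    (shift A ^ n : EdgeShift A ≃ₜ EdgeShift A) '' ray x m = ray ((shift A ^ n) x) (m - n) := by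
  ext z
  constructor
  · rintro ⟨y, hy, rfl⟩ i hi
    rw [shift_zpow_apply, shift_zpow_apply, hy _ (by omega)]
  · intro hz
    obtain ⟨y, rfl⟩ := (shift A ^ n).surjective z
    refine ⟨y, fun i hi => ?_, rfl⟩
    have := hz (i - n) (by omega)
    simpa [shift_zpow_apply] using this

lemma topEntropy_nonpos_of_finite {X : Type*} [UniformSpace X] [Finite X] (f : X → X) :
    topEntropy f ≤ 0 := by
  have := Fintype.ofFinite X
  refine iSup₂_le fun V hV => ?_
  have hle : ∀ n : ℕ, ((Dynamics.coverMincard f univ V n : ℕ∞) : ENNReal) ≤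
      ((Fintype.card X + 1 : ℕ) : ENNReal) := by
    intro n
    have hc : Dynamics.IsDynCoverOf f univ V n ((Finset.univ : Finset X) : Set X) := by
      intro x _
      refine ⟨x, by simp, ?_⟩
      exact Dynamics.mem_dynEntourage.2 fun k _ => refl_mem_uniformity hV
    have h1 : Dynamics.coverMincard f univ V n ≤ ((Fintype.card X + 1 : ℕ) : ℕ∞) :=
      hc.coverMincard_le_card.trans (by rw [Finset.card_univ]; exact_mod_cast Nat.le_succ _)
    simpa using (ENat.toENNReal_mono h1)
  have h2 : Dynamics.coverEntropyEntourage f univ V ≤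
      ExpGrowth.expGrowthSup (fun _ => ((Fintype.card X + 1 : ℕ) : ENNReal)) :=
    ExpGrowth.expGrowthSup_monotone hle
  rwa [ExpGrowth.expGrowthSup_const (by simp) (by simp)] at h2

lemma endRays_univ_finite_of_edge (h : PosIrreducible A) {I J : Fin k} (hIJ : 0 < A I J) {m : ℤ}
    (hf : (endRays (A := A) univ (m + 1) J).Finite) : (endRays (A := A) univ m I).Finite := by
  refine (hf.image (coarsen m)).subset ?_
  rintro _ ⟨x, -, hx, rfl⟩
  obtain ⟨e, he, he'⟩ := exists_edge hIJ
  obtain ⟨y, hy, hye⟩ := h.exists_extension x m e (he.trans hx.symm)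
  refine ⟨_, ⟨y, trivial, by rw [hye, he'], rfl⟩, ?_⟩
  rw [coarsen_ray]
  exact ray_eq_iff.2 hy

lemma endRays_univ_finite_shift {J : Fin k} {m : ℤ} (n : ℤ)
    (hf : (endRays (A := A) univ m J).Finite) : (endRays (A := A) univ n J).Finite := by
  refine (hf.image (fun R => (shift A ^ (m - n) : EdgeShift A ≃ₜ EdgeShift A) '' R)).subset ?_
  rintro _ ⟨x, -, hx, rfl⟩
  obtain ⟨y, rfl⟩ := (shift A ^ (m - n)).surjective x
  refine ⟨_, ⟨y, trivial, ?_, rfl⟩, ?_⟩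
  · rw [shift_zpow_apply] at hx
    simpa using hx
  · simp only [image_zpow_ray]
    rw [sub_sub_cancel]

/-- Infinitely many rays end at each state. -/
lemma PosIrreducible.endRays_univ_infinite (h : PosIrreducible A) (m : ℤ) (J : Fin k) :
    (endRays (A := A) univ m J).Infinite := by
  intro hfin
  have hpow : ∀ t : ℕ, ∀ I, 0 < (A ^ t) I J → (endRays (A := A) univ m I).Finite := by
    intro t
    induction t with
    | zero =>
      intro I hI
      by_cases hIJ : I = J
      · exact hIJ ▸ hfin
      · simp [hIJ] at hI
    | succ t ih =>
      intro I hI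
      rw [pow_succ', Matrix.mul_apply] at hI
      obtain ⟨L, -, hL⟩ := Finset.exists_ne_zero_of_sum_ne_zero hI.ne'
      exact endRays_univ_finite_of_edge h (Nat.pos_of_ne_zero (left_ne_zero_of_mul hL))
        (endRays_univ_finite_shift _ (ih L (Nat.pos_of_ne_zero (right_ne_zero_of_mul hL))))
  have hall : ∀ n : ℤ, (range fun x : EdgeShift A => ray x n).Finite := by
    intro n
    refine (Set.finite_iUnion fun I => endRays_univ_finite_shift (A := A) (J := I) (m := m) n ?_).subset
      (t := range fun x : EdgeShift A => ray x n) ?_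
    · obtain ⟨t, -, ht⟩ := h.exists_pow_pos I J
      exact hpow t I ht
    · rintro _ ⟨x, rfl⟩
      exact mem_iUnion.2 ⟨_, x, trivial, rfl, rfl⟩
  have hstep : ∀ (n : ℤ) (x y : EdgeShift A), ray x n = ray y n → ray x (n + 1) = ray y (n + 1) := by
    intro n x y hxy
    have himg : coarsen n '' (range fun x : EdgeShift A => ray x (n + 1)) =
        range fun x : EdgeShift A => ray x n := by
      rw [← range_comp]
      congr 1
      funext x
      exact coarsen_ray x n
    have himg' : (fun R => (shift A ^ (1 : ℤ) : EdgeShift A ≃ₜ EdgeShift A) '' R) ''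
        (range fun x : EdgeShift A => ray x (n + 1)) = range fun x : EdgeShift A => ray x n := by
      ext R
      constructor
      · rintro ⟨_, ⟨x, rfl⟩, rfl⟩
        refine ⟨(shift A ^ (1 : ℤ)) x, ?_⟩
        simp only [image_zpow_ray]
        rw [add_sub_cancel_right]
      · rintro ⟨x, rfl⟩
        obtain ⟨y, rfl⟩ := (shift A ^ (1 : ℤ)).surjective x
        refine ⟨_, ⟨y, rfl⟩, ?_⟩
        simp only [image_zpow_ray]
        rw [add_sub_cancel_right]
    have hinj' : Function.Injective
        (fun R => (shift A ^ (1 : ℤ) : EdgeShift A ≃ₜ EdgeShift A) '' R) :=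
      Set.image_injective.2 (shift A ^ (1 : ℤ)).injective
    have hc : (range fun x : EdgeShift A => ray x n).ncard =
        (range fun x : EdgeShift A => ray x (n + 1)).ncard := by
      conv_lhs => rw [← himg']
      exact Set.ncard_image_of_injective _ hinj'
    have hinj : Set.InjOn (coarsen n) (range fun x : EdgeShift A => ray x (n + 1)) :=
      Set.injOn_of_ncard_image_eq (by rw [himg, hc]) (hall _)
    exact hinj ⟨x, rfl⟩ ⟨y, rfl⟩ (by rw [coarsen_ray, coarsen_ray, hxy])
  have hinj : Function.Injective fun x : EdgeShift A => ray x 0 := by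
    intro x y hxy
    have : ∀ n : ℕ, ray x n = ray y n := by
      intro n
      induction n with
      | zero => exact hxy
      | succ n ih => exact_mod_cast hstep n x y ih
    refine Subtype.ext (funext fun i => ?_)
    exact ray_eq_iff.1 (this i.toNat) i (by omega)
  have : Finite (EdgeShift A) := by
    have := (hall 0).to_subtype
    exact Finite.of_injective (fun x => (⟨ray x 0, x, rfl⟩ : range fun x : EdgeShift A => ray x 0))
      fun x y hxy => hinj (congrArg Subtype.val hxy)
  exact absurd h.entropy_pos (not_lt.2 (topEntropy_nonpos_of_finite _))

/-- Every vector over `ℤ₊` is `v_{V,m}` for an `m`-beam `V` that avoids a given `m`-beam. -/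
lemma PosIrreducible.exists_beam (h : PosIrreducible A) {U : Set (EdgeShift A)} {m : ℤ}
    (hU : IsBeam U m) (u : Fin k → ℕ) :
    ∃ V : Set (EdgeShift A), IsBeam V m ∧ Disjoint U V ∧ endCount V m = u := by
  have hinf : ∀ J, (endRays (A := A) univ m J \ endRays U m J).Infinite := fun J =>
    (h.endRays_univ_infinite m J).sdiff (endRays_finite hU J)
  have hex : ∀ J, ∃ t ⊆ endRays (A := A) univ m J \ endRays U m J, t.Finite ∧ t.ncard = u J :=
    fun J => (hinf J).exists_subset_ncard_eq (u J)
  choose t htsub htfin htcard using hex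
  have hmem : ∀ J, ∀ R ∈ t J, ∀ x ∈ R, ray x m = R ∧ (x.1 m).tgt = J := by
    intro J R hR x hx
    obtain ⟨y, -, hy, rfl⟩ := (htsub J hR).1
    exact ⟨ray_eq_iff.2 hx, by rw [hx m le_rfl, hy]⟩
  have hne : ∀ J, ∀ R ∈ t J, ∃ x, x ∈ R := by
    intro J R hR
    obtain ⟨y, -, hy, rfl⟩ := (htsub J hR).1
    exact ⟨y, fun _ _ => rfl⟩
  let V : Set (EdgeShift A) := {x | ∃ J, ray x m ∈ t J}
  have hV : ∀ J, endRays V m J = t J := by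
    intro J
    ext R
    constructor
    · rintro ⟨x, ⟨J', hx⟩, hJ, rfl⟩
      have := (hmem J' _ hx x fun _ _ => rfl).2
      rw [← hJ, this]
      exact hx
    · intro hR
      obtain ⟨x, hx⟩ := hne J R hR
      obtain ⟨h1, h2⟩ := hmem J R hR x hx
      exact ⟨x, ⟨J, h1 ▸ hR⟩, h2, h1⟩
  refine ⟨V, isBeam_iff.2 ⟨?_, ?_⟩, ?_, ?_⟩
  · rintro x ⟨J, hx⟩ y hy
    exact ⟨J, by rwa [ray_eq_iff.2 hy]⟩
  · refine (Set.finite_iUnion htfin).subset ?_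
    rintro _ ⟨x, ⟨J, hx⟩, rfl⟩
    exact mem_iUnion.2 ⟨J, hx⟩
  · rw [Set.disjoint_left]
    rintro x hx ⟨J, hxJ⟩
    exact (htsub J hxJ).2 ⟨x, hx, (hmem J _ hxJ x fun _ _ => rfl).2, rfl⟩
  · funext J
    rw [endCount, hV, htcard]

/-! ### The dimension triple of the matrix `A` -/

/-- `A` as a rational matrix; it acts on row vectors. -/
abbrev ratMatrix (A : Matrix (Fin k) (Fin k) ℕ) : Matrix (Fin k) (Fin k) ℚ :=
  A.map (Nat.cast : ℕ → ℚ)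

/-- The eventual range `R(A) = ℚ^k A^k`. -/
def eventualRange (A : Matrix (Fin k) (Fin k) ℕ) : Submodule ℚ (Fin k → ℚ) :=
  LinearMap.range (ratMatrix A ^ k).vecMulLinear

lemma ratMatrix_pow (m : ℕ) : ratMatrix A ^ m = (A ^ m).map (Nat.cast : ℕ → ℚ) :=
  (map_pow (Nat.castRingHom ℚ).mapMatrix A m).symm

lemma cast_vecMul (u : Fin k → ℕ) (m : ℕ) :
    (fun i => ((Matrix.vecMul u (A ^ m) i : ℕ) : ℚ)) =
      Matrix.vecMul (fun i => (u i : ℚ)) (ratMatrix A ^ m) := by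
  funext i
  rw [ratMatrix_pow]
  exact RingHom.map_vecMul (Nat.castRingHom ℚ) (A ^ m) u i

lemma cast_vecMul_int (u : Fin k → ℤ) (m : ℕ) :
    (fun i => ((Matrix.vecMul u ((A ^ m).map (Nat.cast : ℕ → ℤ)) i : ℤ) : ℚ)) =
      Matrix.vecMul (fun i => (u i : ℚ)) (ratMatrix A ^ m) := by
  funext i
  rw [ratMatrix_pow]
  have := RingHom.map_vecMul (Int.castRingHom ℚ) ((A ^ m).map (Nat.cast : ℕ → ℤ)) u i
  rw [Matrix.map_map] at this
  simpa [Function.comp_def] using this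

/-- `𝒢_A = {x ∈ R(A) | x A^m ∈ ℤ^k for some m ≥ 0}`. -/
def dimGroup (A : Matrix (Fin k) (Fin k) ℕ) : AddSubgroup (Fin k → ℚ) where
  carrier := {x | x ∈ eventualRange A ∧
    ∃ (m : ℕ) (u : Fin k → ℤ), Matrix.vecMul x (ratMatrix A ^ m) = fun i => (u i : ℚ)}
  zero_mem' := ⟨Submodule.zero_mem _, 0, 0, by ext; simp⟩
  add_mem' := by
    rintro x y ⟨hx, m, u, hu⟩ ⟨hy, n, v, hv⟩
    refine ⟨Submodule.add_mem _ hx hy, m + n,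
      Matrix.vecMul u ((A ^ n).map (Nat.cast : ℕ → ℤ)) +
        Matrix.vecMul v ((A ^ m).map (Nat.cast : ℕ → ℤ)), ?_⟩
    have h1 := cast_vecMul_int (A := A) u n
    have h2 := cast_vecMul_int (A := A) v m
    rw [Matrix.add_vecMul, pow_add, ← Matrix.vecMul_vecMul, hu, ← h1,
      ← pow_add, add_comm m n, pow_add, ← Matrix.vecMul_vecMul, hv, ← h2]
    ext i; simp
  neg_mem' := by
    rintro x ⟨hx, m, u, hu⟩
    refine ⟨Submodule.neg_mem _ hx, m, -u, ?_⟩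
    rw [Matrix.neg_vecMul, hu]
    ext; simp

/-- `𝒢_A⁺ = {x ∈ R(A) | x A^m ∈ (ℤ₊)^k for some m ≥ 0}`, as a subsemigroup of `𝒢_A`. -/
def dimCone (A : Matrix (Fin k) (Fin k) ℕ) : AddSubmonoid (dimGroup A) where
  carrier := {x | ∃ (m : ℕ) (u : Fin k → ℕ),
    Matrix.vecMul x.1 (ratMatrix A ^ m) = fun i => (u i : ℚ)}
  zero_mem' := ⟨0, 0, by ext; simp⟩
  add_mem' := by
    rintro x y ⟨m, u, hu⟩ ⟨n, v, hv⟩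
    refine ⟨m + n, Matrix.vecMul u (A ^ n) + Matrix.vecMul v (A ^ m), ?_⟩
    have h1 := cast_vecMul (A := A) u n
    have h2 := cast_vecMul (A := A) v m
    rw [AddSubgroup.coe_add, Matrix.add_vecMul, pow_add, ← Matrix.vecMul_vecMul, hu, ← h1,
      ← pow_add, add_comm m n, pow_add, ← Matrix.vecMul_vecMul, hv, ← h2]
    ext i; simp

lemma mem_eventualRange {x : Fin k → ℚ} :
    x ∈ eventualRange A ↔ ∃ y, Matrix.vecMul y (ratMatrix A ^ k) = x := Iff.rfl

lemma vecMul_mem_eventualRange {x : Fin k → ℚ} (hx : x ∈ eventualRange A) :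
    Matrix.vecMul x (ratMatrix A) ∈ eventualRange A := by
  obtain ⟨y, rfl⟩ := mem_eventualRange.1 hx
  exact ⟨Matrix.vecMul y (ratMatrix A), by
    rw [Matrix.vecMulLinear_apply, Matrix.vecMul_vecMul, Matrix.vecMul_vecMul, ← pow_succ',
      ← pow_succ]⟩

lemma vecMulLinear_pow (B : Matrix (Fin k) (Fin k) ℚ) (m : ℕ) :
    (B.vecMulLinear : Module.End ℚ (Fin k → ℚ)) ^ m = (B ^ m).vecMulLinear := by
  induction m with
  | zero => ext; simp
  | succ m ih =>
    refine LinearMap.ext fun x => ?_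
    rw [pow_succ', ih, Module.End.mul_apply, Matrix.vecMulLinear_apply, Matrix.vecMulLinear_apply,
      Matrix.vecMulLinear_apply, Matrix.vecMul_vecMul, pow_succ]

lemma eq_zero_of_vecMul_eq_zero {x : Fin k → ℚ} (hx : x ∈ eventualRange A)
    (h : Matrix.vecMul x (ratMatrix A) = 0) : x = 0 := by
  obtain ⟨y, rfl⟩ := mem_eventualRange.1 hx
  have hfin : Module.finrank ℚ (Fin k → ℚ) = k := by simp
  have hker := Module.End.ker_pow_eq_ker_pow_finrank_of_le
    (f := ((ratMatrix A).vecMulLinear : Module.End ℚ (Fin k → ℚ))) (m := k + 1) (by omega)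
  rw [hfin, vecMulLinear_pow, vecMulLinear_pow] at hker
  have : y ∈ LinearMap.ker (ratMatrix A ^ k).vecMulLinear := by
    rw [← hker, LinearMap.mem_ker, Matrix.vecMulLinear_apply, pow_succ, ← Matrix.vecMul_vecMul, h]
  exact this

lemma exists_vecMul_eq {x : Fin k → ℚ} (hx : x ∈ eventualRange A) :
    ∃ y ∈ eventualRange A, Matrix.vecMul y (ratMatrix A) = x := by
  let f : eventualRange A →ₗ[ℚ] eventualRange A :=
    (ratMatrix A).vecMulLinear.restrict fun x hx => vecMul_mem_eventualRange hx
  have hf : Function.Injective f := by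
    rw [← LinearMap.ker_eq_bot, LinearMap.ker_eq_bot']
    intro z hz
    exact Subtype.ext (eq_zero_of_vecMul_eq_zero z.2 (congrArg Subtype.val hz))
  obtain ⟨y, hy⟩ := LinearMap.injective_iff_surjective.1 hf ⟨x, hx⟩
  exact ⟨y, y.2, congrArg Subtype.val hy⟩

/-- `x ↦ x A` as an endomorphism of `𝒢_A`. -/
def dimShiftHom (A : Matrix (Fin k) (Fin k) ℕ) : dimGroup A →+ dimGroup A where
  toFun x := ⟨Matrix.vecMul x.1 (ratMatrix A), vecMul_mem_eventualRange x.2.1, by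
    obtain ⟨m, u, hu⟩ := x.2.2
    refine ⟨m, Matrix.vecMul u ((A ^ 1).map (Nat.cast : ℕ → ℤ)), ?_⟩
    rw [cast_vecMul_int, ← hu, Matrix.vecMul_vecMul, Matrix.vecMul_vecMul, pow_one, ← pow_succ,
      ← pow_succ']⟩
  map_zero' := Subtype.ext (Matrix.zero_vecMul (ratMatrix A))
  map_add' x y := Subtype.ext (Matrix.add_vecMul (ratMatrix A) x.1 y.1)

lemma coe_dimShiftHom (x : dimGroup A) :
    (dimShiftHom A x : Fin k → ℚ) = Matrix.vecMul x.1 (ratMatrix A) := rfl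

lemma dimShiftHom_bijective : Function.Bijective (dimShiftHom A) := by
  constructor
  · rw [injective_iff_map_eq_zero]
    intro x hx
    exact Subtype.ext (eq_zero_of_vecMul_eq_zero x.2.1 (congrArg Subtype.val hx))
  · rintro ⟨x, hx, m, u, hu⟩
    obtain ⟨y, hy, rfl⟩ := exists_vecMul_eq hx
    refine ⟨⟨y, hy, m + 1, u, ?_⟩, rfl⟩
    rw [← hu, Matrix.vecMul_vecMul, ← pow_succ']

/-- The group (under composition) of automorphisms of an abelian group `G`; a group automorphism
is the same thing as a `ℤ`-linear one. -/
abbrev GroupAut (G : Type*) [AddCommGroup G] : Type _ := G ≃ₗ[ℤ] G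

/-- The automorphism `δ_A : x ↦ x A` of `𝒢_A`. -/
noncomputable def dimShift (A : Matrix (Fin k) (Fin k) ℕ) : GroupAut (dimGroup A) :=
  (AddEquiv.ofBijective (dimShiftHom A) dimShiftHom_bijective).toIntLinearEquiv

lemma coe_dimShift (x : dimGroup A) :
    (dimShift A x : Fin k → ℚ) = Matrix.vecMul x.1 (ratMatrix A) := rfl

lemma coe_dimShift_pow (n : ℕ) (x : dimGroup A) :
    ((dimShift A ^ n) x : Fin k → ℚ) = Matrix.vecMul x.1 (ratMatrix A ^ n) := by
  induction n with
  | zero => simp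
  | succ n ih =>
    rw [pow_succ', LinearEquiv.mul_apply, coe_dimShift, ih, Matrix.vecMul_vecMul, pow_succ]

/-- `Aut(𝒢_A, 𝒢_A⁺, δ_A)`: the group automorphisms of `𝒢_A` that take `𝒢_A⁺` onto `𝒢_A⁺` and
commute with `δ_A`. -/
def DimAut (A : Matrix (Fin k) (Fin k) ℕ) : Subgroup (GroupAut (dimGroup A)) where
  carrier := {Φ | Φ '' (dimCone A : Set (dimGroup A)) = dimCone A ∧
    Φ * dimShift A = dimShift A * Φ}
  one_mem' := ⟨by simp, by simp⟩
  mul_mem' := by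
    rintro Φ Ψ ⟨h1, h2⟩ ⟨h3, h4⟩
    refine ⟨?_, ?_⟩
    · have : (⇑(Φ * Ψ) : dimGroup A → dimGroup A) = Φ ∘ Ψ := rfl
      rw [this, image_comp, h3, h1]
    · rw [mul_assoc, h4, ← mul_assoc, h2, mul_assoc]
  inv_mem' := by
    rintro Φ ⟨h1, h2⟩
    refine ⟨?_, ?_⟩
    · conv_lhs => rw [← h1]
      rw [← image_comp]
      have : (⇑(Φ⁻¹) ∘ ⇑Φ : dimGroup A → dimGroup A) = id := by
        funext x; exact LinearEquiv.symm_apply_apply Φ x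
      rw [this, image_id]
    · exact ((show Commute Φ (dimShift A) from h2).inv_left).eq

/-! ### Krieger's dimension triple and the dimension representation -/

/-- Beams: sets that are `m`-beams for some `m`. -/
def Beam (A : Matrix (Fin k) (Fin k) ℕ) : Type := {U : Set (EdgeShift A) // ∃ m, IsBeam U m}

/-- Beams `U`, `V` are equivalent if `v_{U,m} = v_{V,m}` for some `m` (for which both are
`m`-beams). -/
def BeamEquiv (U V : Beam A) : Prop :=
  ∃ m, IsBeam U.1 m ∧ IsBeam V.1 m ∧ endCount U.1 m = endCount V.1 m

lemma PosIrreducible.endCount_eq_mono (h : PosIrreducible A) {U V : Set (EdgeShift A)} {m n : ℤ}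
    (hU : IsBeam U m) (hV : IsBeam V m) (he : endCount U m = endCount V m) (hmn : m ≤ n) :
    endCount U n = endCount V n := by
  obtain ⟨d, rfl⟩ := Int.le.dest hmn
  rw [h.endCount_add hU, h.endCount_add hV, he]

/-- Equivalence of beams, as a setoid. -/
def beamSetoid (h : PosIrreducible A) : Setoid (Beam A) where
  r := BeamEquiv
  iseqv := {
    refl := fun U => ⟨U.2.choose, U.2.choose_spec, U.2.choose_spec, rfl⟩
    symm := fun ⟨m, h1, h2, h3⟩ => ⟨m, h2, h1, h3.symm⟩
    trans := by
      rintro U V W ⟨m, h1, h2, h3⟩ ⟨n, h4, h5, h6⟩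
      refine ⟨max m n, h1.mono (le_max_left _ _), h5.mono (le_max_right _ _), ?_⟩
      rw [h.endCount_eq_mono h1 h2 h3 (le_max_left _ _),
        h.endCount_eq_mono h4 h5 h6 (le_max_right _ _)] }

/-- The set `D_A⁺` of equivalence classes of beams. -/
def KriegerCone (h : PosIrreducible A) : Type := Quotient (beamSetoid h)

/-- The class `[U]` of a beam. -/
def KriegerCone.mk (h : PosIrreducible A) (U : Beam A) : KriegerCone h :=
  Quotient.mk (beamSetoid h) U

lemma KriegerCone.mk_eq_iff {h : PosIrreducible A} {U V : Beam A} :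
    KriegerCone.mk h U = KriegerCone.mk h V ↔ BeamEquiv U V :=
  Quotient.eq (r := beamSetoid h)

lemma KriegerCone.mk_surjective {h : PosIrreducible A} (a : KriegerCone h) :
    ∃ U, KriegerCone.mk h U = a := Quotient.exists_rep a

/-- The union of two beams. -/
def Beam.union (U V : Beam A) : Beam A :=
  ⟨U.1 ∪ V.1, by
    obtain ⟨m, hm⟩ := U.2
    obtain ⟨n, hn⟩ := V.2
    exact ⟨max m n, (hm.mono (le_max_left _ _)).union (hn.mono (le_max_right _ _))⟩⟩

/-- The empty beam. -/
def Beam.empty (A : Matrix (Fin k) (Fin k) ℕ) : Beam A := ⟨∅, 0, ∅, Set.finite_empty, by simp⟩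

/-- Two classes of beams have disjoint representatives. -/
lemma KriegerCone.exists_disjoint {h : PosIrreducible A} (a b : KriegerCone h) :
    ∃ p : Beam A × Beam A, KriegerCone.mk h p.1 = a ∧ KriegerCone.mk h p.2 = b ∧
      Disjoint p.1.1 p.2.1 := by
  obtain ⟨U, rfl⟩ := a.mk_surjective
  obtain ⟨V, rfl⟩ := b.mk_surjective
  obtain ⟨m, hm⟩ := U.2
  obtain ⟨n, hn⟩ := V.2
  obtain ⟨W, hW, hd, hc⟩ := h.exists_beam (hm.mono (le_max_left m n)) (endCount V.1 (max m n))
  exact ⟨⟨U, ⟨W, _, hW⟩⟩, rfl,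
    KriegerCone.mk_eq_iff.2 ⟨_, hW, hn.mono (le_max_right m n), hc⟩, hd⟩

/-- `[U] + [V] = [U' ∪ V']` where `[U] = [U']`, `[V] = [V']` and `U' ∩ V' = ∅`. -/
noncomputable instance (h : PosIrreducible A) : Add (KriegerCone h) where
  add a b := KriegerCone.mk h
    ((KriegerCone.exists_disjoint a b).choose.1.union (KriegerCone.exists_disjoint a b).choose.2)

instance (h : PosIrreducible A) : Zero (KriegerCone h) where
  zero := KriegerCone.mk h (Beam.empty A)

lemma BeamEquiv.union {h : PosIrreducible A} {U V U' V' : Beam A} (hU : BeamEquiv U U')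
    (hV : BeamEquiv V V') (hd : Disjoint U.1 V.1) (hd' : Disjoint U'.1 V'.1) :
    BeamEquiv (U.union V) (U'.union V') := by
  obtain ⟨m, h1, h2, h3⟩ := hU
  obtain ⟨n, h4, h5, h6⟩ := hV
  have h1' := h1.mono (le_max_left m n)
  have h2' := h2.mono (le_max_left m n)
  have h4' := h4.mono (le_max_right m n)
  have h5' := h5.mono (le_max_right m n)
  refine ⟨max m n, h1'.union h4', h2'.union h5', ?_⟩
  funext J
  change endCount (U.1 ∪ V.1) _ J = endCount (U'.1 ∪ V'.1) _ J
  rw [endCount_union h1' h4' hd, endCount_union h2' h5' hd',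
    h.endCount_eq_mono h1 h2 h3 (le_max_left _ _), h.endCount_eq_mono h4 h5 h6 (le_max_right _ _)]

/-- The sum can be computed from any disjoint representatives. -/
lemma KriegerCone.mk_add_mk {h : PosIrreducible A} {U V : Beam A} (hd : Disjoint U.1 V.1) :
    KriegerCone.mk h U + KriegerCone.mk h V = KriegerCone.mk h (U.union V) := by
  have hs := (KriegerCone.exists_disjoint (KriegerCone.mk h U) (KriegerCone.mk h V)).choose_spec
  exact KriegerCone.mk_eq_iff.2 (BeamEquiv.union (h := h) (KriegerCone.mk_eq_iff.1 hs.1)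
    (KriegerCone.mk_eq_iff.1 hs.2.1) hs.2.2 hd)

/-- The vector `v A^k ∈ 𝒢_A`, for `v ∈ (ℤ₊)^k`. -/
def ofVec (A : Matrix (Fin k) (Fin k) ℕ) (v : Fin k → ℕ) : dimGroup A :=
  ⟨Matrix.vecMul (fun i => (v i : ℚ)) (ratMatrix A ^ k), ⟨_, rfl⟩, 0,
    fun i => ((Matrix.vecMul v (A ^ k) i : ℕ) : ℤ), by
      rw [← cast_vecMul]; ext; simp⟩

/-- `δ_A^{-k-n}(v_{U,n} A^k)`. -/
noncomputable def thetaAt (U : Set (EdgeShift A)) (n : ℤ) : dimGroup A :=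
  (dimShift A ^ (-(k : ℤ) - n)) (ofVec A (endCount U n))

lemma coe_ofVec (v : Fin k → ℕ) : (ofVec A v : Fin k → ℚ) =
    Matrix.vecMul (fun i => (v i : ℚ)) (ratMatrix A ^ k) := rfl

lemma ofVec_vecMul (v : Fin k → ℕ) (m : ℕ) :
    ofVec A (Matrix.vecMul v (A ^ m)) = (dimShift A ^ m) (ofVec A v) := by
  refine Subtype.ext ?_
  rw [coe_dimShift_pow, coe_ofVec, coe_ofVec, cast_vecMul, Matrix.vecMul_vecMul, Matrix.vecMul_vecMul, ← pow_add, ← pow_add, add_comm]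

lemma thetaAt_mono (h : PosIrreducible A) {U : Set (EdgeShift A)} {m n : ℤ} (hU : IsBeam U m)
    (hmn : m ≤ n) : thetaAt U n = thetaAt U m := by
  obtain ⟨d, rfl⟩ := Int.le.dest hmn
  rw [thetaAt, thetaAt, h.endCount_add hU, ofVec_vecMul, ← zpow_natCast, ← LinearEquiv.mul_apply,
    ← zpow_add]
  congr 2; ring

lemma thetaAt_eq (h : PosIrreducible A) {U : Set (EdgeShift A)} {m n : ℤ} (hm : IsBeam U m)
    (hn : IsBeam U n) : thetaAt U n = thetaAt U m := by
  rw [← thetaAt_mono h hm (le_max_left m n), ← thetaAt_mono h hn (le_max_right m n)]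

/-- `θ([U]) = δ_A^{-k-n}(v_{U,n} A^k)` for an `n`-beam `U`. -/
noncomputable def KriegerCone.theta {h : PosIrreducible A} : KriegerCone h → dimGroup A :=
  Quotient.lift (fun U : Beam A => thetaAt U.1 U.2.choose) (by
    rintro U V ⟨m, h1, h2, h3⟩
    rw [thetaAt_eq h h1 U.2.choose_spec, thetaAt_eq h h2 V.2.choose_spec, thetaAt, thetaAt, h3])

lemma KriegerCone.theta_mk {h : PosIrreducible A} {U : Beam A} {n : ℤ} (hn : IsBeam U.1 n) :
    (KriegerCone.mk h U).theta = (dimShift A ^ (-(k : ℤ) - n)) (ofVec A (endCount U.1 n)) :=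
  thetaAt_eq h hn U.2.choose_spec

lemma KriegerCone.theta_injective {h : PosIrreducible A} :
    Function.Injective (KriegerCone.theta (h := h)) := by
  intro a b hab
  obtain ⟨U, rfl⟩ := a.mk_surjective
  obtain ⟨V, rfl⟩ := b.mk_surjective
  obtain ⟨m, hm⟩ := U.2
  obtain ⟨n, hn⟩ := V.2
  have hm' := hm.mono (le_max_left m n)
  have hn' := hn.mono (le_max_right m n)
  rw [KriegerCone.theta_mk hm', KriegerCone.theta_mk hn'] at hab
  have h1 := congrArg Subtype.val ((dimShift A ^ (-(k : ℤ) - max m n)).injective hab)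
  rw [coe_ofVec, coe_ofVec, ← cast_vecMul, ← cast_vecMul] at h1
  refine KriegerCone.mk_eq_iff.2 ⟨max m n + k, hm'.mono (by omega), hn'.mono (by omega), ?_⟩
  rw [h.endCount_add hm', h.endCount_add hn']
  funext i
  exact_mod_cast congrFun h1 i

lemma ofVec_add (u v : Fin k → ℕ) : ofVec A (u + v) = ofVec A u + ofVec A v := by
  refine Subtype.ext ?_
  rw [AddSubgroup.coe_add, coe_ofVec, coe_ofVec, coe_ofVec, ← Matrix.add_vecMul]
  congr 1
  ext i; simp

lemma ofVec_zero : ofVec A (0 : Fin k → ℕ) = 0 := by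
  have h := ofVec_add (A := A) 0 0
  rw [add_zero] at h
  exact left_eq_add.1 h

lemma endCount_empty (m : ℤ) : endCount (∅ : Set (EdgeShift A)) m = 0 := by
  funext J
  simp [endCount, endRays]

lemma isBeam_empty (m : ℤ) : IsBeam (∅ : Set (EdgeShift A)) m := ⟨∅, Set.finite_empty, by simp⟩

lemma KriegerCone.theta_zero {h : PosIrreducible A} : (0 : KriegerCone h).theta = 0 := by
  refine (KriegerCone.theta_mk (U := Beam.empty A) (isBeam_empty 0)).trans ?_
  rw [show (Beam.empty A).1 = ∅ from rfl, endCount_empty, ofVec_zero, map_zero]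

lemma KriegerCone.theta_add {h : PosIrreducible A} (a b : KriegerCone h) :
    (a + b).theta = a.theta + b.theta := by
  obtain ⟨⟨U, V⟩, rfl, rfl, hd⟩ := KriegerCone.exists_disjoint a b
  obtain ⟨m, hm⟩ := U.2
  obtain ⟨n, hn⟩ := V.2
  have hm' := hm.mono (le_max_left m n)
  have hn' := hn.mono (le_max_right m n)
  rw [KriegerCone.mk_add_mk hd, KriegerCone.theta_mk hm', KriegerCone.theta_mk hn',
    KriegerCone.theta_mk (U := U.union V) (hm'.union hn'), ← map_add, ← ofVec_add]
  congr 2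
  funext J
  exact endCount_union hm' hn' hd J

/-- The abelian semigroup `D_A⁺`. -/
noncomputable instance (h : PosIrreducible A) : AddCommMonoid (KriegerCone h) where
  add_assoc a b c := KriegerCone.theta_injective (by simp only [KriegerCone.theta_add, add_assoc])
  zero_add a := KriegerCone.theta_injective (by
    simp only [KriegerCone.theta_add, KriegerCone.theta_zero, zero_add])
  add_zero a := KriegerCone.theta_injective (by
    simp only [KriegerCone.theta_add, KriegerCone.theta_zero, add_zero])
  add_comm a b := KriegerCone.theta_injective (by simp only [KriegerCone.theta_add, add_comm])
  nsmul := nsmulRec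

/-- `D_A`, the group completion of `D_A⁺`. -/
abbrev KriegerGroup (h : PosIrreducible A) : Type := Algebra.GrothendieckAddGroup (KriegerCone h)

/-- `θ : D_A⁺ → 𝒢_A` as a homomorphism. -/
noncomputable def KriegerCone.thetaHom (h : PosIrreducible A) : KriegerCone h →+ dimGroup A where
  toFun := KriegerCone.theta
  map_zero' := KriegerCone.theta_zero
  map_add' := KriegerCone.theta_add

/-- `θ(D_A⁺) = 𝒢_A⁺`. -/
lemma KriegerCone.range_theta (h : PosIrreducible A) :
    range (KriegerCone.theta (h := h)) = (dimCone A : Set (dimGroup A)) := by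
  ext x
  constructor
  · rintro ⟨a, rfl⟩
    obtain ⟨U, rfl⟩ := a.mk_surjective
    obtain ⟨m, hm⟩ := U.2
    have hm' := hm.mono (le_max_left m 0)
    obtain ⟨d, hd⟩ := Int.eq_ofNat_of_zero_le (le_max_right m 0)
    refine ⟨k + d, Matrix.vecMul (endCount U.1 (max m 0)) (A ^ k), ?_⟩
    rw [← coe_dimShift_pow, KriegerCone.theta_mk hm', ← zpow_natCast, ← LinearEquiv.mul_apply,
      ← zpow_add, hd, cast_vecMul]
    rw [show ((k + d : ℕ) : ℤ) + (-(k : ℤ) - (d : ℤ)) = 0 by push_cast; ring, zpow_zero]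
    rfl
  · rintro ⟨m, u, hu⟩
    obtain ⟨V, hV, -, hc⟩ := h.exists_beam (isBeam_empty (m : ℤ)) u
    refine ⟨KriegerCone.mk h ⟨V, _, hV⟩, ?_⟩
    rw [KriegerCone.theta_mk (U := ⟨V, _, hV⟩) hV, hc]
    have : ofVec A u = (dimShift A ^ ((k : ℤ) + m)) x := by
      refine Subtype.ext ?_
      rw [show (k : ℤ) + m = ((m + k : ℕ) : ℤ) by push_cast; ring, zpow_natCast, coe_dimShift_pow,
        pow_add, ← Matrix.vecMul_vecMul, hu]
      rfl
    rw [this, ← LinearEquiv.mul_apply, ← zpow_add,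
      show -(k : ℤ) - m + (k + m) = 0 by ring, zpow_zero]; rfl

lemma dimGroup_eq_sub (x : dimGroup A) : ∃ a ∈ dimCone A, ∃ b ∈ dimCone A, x = a - b := by
  obtain ⟨m, u, hu⟩ := x.2.2
  have hcone : ∀ v : Fin k → ℕ, (dimShift A ^ (-(k : ℤ) - m)) (ofVec A v) ∈ dimCone A := by
    intro v
    refine ⟨k + m, Matrix.vecMul v (A ^ k), ?_⟩
    rw [← coe_dimShift_pow, ← zpow_natCast, ← LinearEquiv.mul_apply, ← zpow_add, cast_vecMul]
    rw [show ((k + m : ℕ) : ℤ) + (-(k : ℤ) - (m : ℤ)) = 0 by push_cast; ring, zpow_zero]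
    rfl
  refine ⟨_, hcone fun i => (u i).toNat, _, hcone fun i => (-u i).toNat, ?_⟩
  rw [← map_sub]
  have : ofVec A (fun i => (u i).toNat) - ofVec A (fun i => (-u i).toNat) =
      (dimShift A ^ ((k : ℤ) + m)) x := by
    refine Subtype.ext ?_
    rw [show (k : ℤ) + m = ((m + k : ℕ) : ℤ) by push_cast; ring, zpow_natCast, coe_dimShift_pow,
        pow_add, ← Matrix.vecMul_vecMul, hu]
    rw [AddSubgroup.coe_sub, coe_ofVec, coe_ofVec, ← Matrix.sub_vecMul]
    congr 1
    ext i
    have : ((u i).toNat : ℤ) - ((-u i).toNat : ℤ) = u i := by omega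
    simp only [Pi.sub_apply]
    exact_mod_cast this
  rw [this, ← LinearEquiv.mul_apply, ← zpow_add,
      show -(k : ℤ) - m + (k + m) = 0 by ring, zpow_zero]; rfl

/-- Elements of `D_A` are formal differences. -/
lemma KriegerGroup.exists_sub {h : PosIrreducible A} (x : KriegerGroup h) :
    ∃ a b : KriegerCone h, x = Algebra.GrothendieckAddGroup.of a -
      Algebra.GrothendieckAddGroup.of b := by
  induction x using AddLocalization.ind with
  | _ y =>
    obtain ⟨a, b, hb⟩ := y
    refine ⟨a, b, ?_⟩
    have hof : ∀ c : KriegerCone h,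
        Algebra.GrothendieckAddGroup.of c = AddLocalization.mk c (0 : (⊤ : AddSubmonoid _)) :=
      fun c => (AddLocalization.mk_zero_eq_addMonoidOf_mk c).symm
    rw [hof, hof, Algebra.GrothendieckAddGroup.mk_sub_mk]
    congr 1
    · simp
    · exact Subtype.ext (by simp)

lemma KriegerGroup.lift_of {h : PosIrreducible A} {G : Type*} [AddCommGroup G]
    (f : KriegerCone h →+ G) (a : KriegerCone h) :
    Algebra.GrothendieckAddGroup.lift f (Algebra.GrothendieckAddGroup.of a) = f a :=
  DFunLike.congr_fun (Algebra.GrothendieckAddGroup.lift.symm_apply_apply f) a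

/-- The isomorphism `θ : D_A → 𝒢_A` induced by `θ : D_A⁺ → 𝒢_A⁺`. -/
noncomputable def theta (h : PosIrreducible A) : KriegerGroup h ≃+ dimGroup A :=
  AddEquiv.ofBijective (Algebra.GrothendieckAddGroup.lift (KriegerCone.thetaHom h)) (by
    constructor
    · rw [injective_iff_map_eq_zero]
      intro x hx
      obtain ⟨a, b, rfl⟩ := KriegerGroup.exists_sub x
      rw [map_sub, KriegerGroup.lift_of, KriegerGroup.lift_of, sub_eq_zero] at hx
      rw [KriegerCone.theta_injective hx, sub_self]
    · intro x
      obtain ⟨a, ha, b, hb, rfl⟩ := dimGroup_eq_sub x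
      rw [← SetLike.mem_coe, ← KriegerCone.range_theta h] at ha hb
      obtain ⟨a, rfl⟩ := ha
      obtain ⟨b, rfl⟩ := hb
      refine ⟨Algebra.GrothendieckAddGroup.of a - Algebra.GrothendieckAddGroup.of b, ?_⟩
      rw [map_sub, KriegerGroup.lift_of, KriegerGroup.lift_of]
      rfl)

lemma theta_of (h : PosIrreducible A) (a : KriegerCone h) :
    theta h (Algebra.GrothendieckAddGroup.of a) = a.theta :=
  KriegerGroup.lift_of _ a

/-- The image `φ(U)` of a beam. -/
def Beam.map (φ : AutShift A) (U : Beam A) : Beam A :=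
  ⟨φ.1 '' U.1, by
    obtain ⟨m, hm⟩ := U.2
    obtain ⟨N, hN, hN'⟩ := AutShift.exists_window₂ φ
    exact ⟨_, hm.image_aut φ hN hN'⟩⟩

lemma BeamEquiv.map (φ : AutShift A) {U V : Beam A} (hUV : BeamEquiv U V) :
    BeamEquiv (U.map φ) (V.map φ) := by
  obtain ⟨m, h1, h2, h3⟩ := hUV
  obtain ⟨N, hN, hN'⟩ := AutShift.exists_window₂ φ
  exact ⟨_, (h1.image_aut φ hN hN').mono (by omega), (h2.image_aut φ hN hN').mono (by omega),
    endCount_image_aut φ hN hN' h1 h2 h3⟩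

/-- `φ_* : D_A⁺ → D_A⁺`, `φ_*([U]) = [φ(U)]`. -/
def KriegerCone.map (h : PosIrreducible A) (φ : AutShift A) : KriegerCone h →+ KriegerCone h where
  toFun := Quotient.map (Beam.map φ) fun _ _ hUV => BeamEquiv.map φ hUV
  map_zero' := by
    change KriegerCone.mk h (Beam.map φ (Beam.empty A)) = KriegerCone.mk h (Beam.empty A)
    congr 1
    exact Subtype.ext (image_empty _)
  map_add' a b := by
    obtain ⟨⟨U, V⟩, rfl, rfl, hd⟩ := KriegerCone.exists_disjoint a b
    rw [KriegerCone.mk_add_mk hd]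
    change KriegerCone.mk h (Beam.map φ (U.union V)) =
      KriegerCone.mk h (Beam.map φ U) + KriegerCone.mk h (Beam.map φ V)
    rw [KriegerCone.mk_add_mk ((Set.disjoint_image_iff φ.1.injective).2 hd)]
    congr 1
    exact Subtype.ext (image_union _ _ _)

lemma KriegerCone.map_mk (h : PosIrreducible A) (φ : AutShift A) (U : Beam A) :
    KriegerCone.map h φ (KriegerCone.mk h U) = KriegerCone.mk h (U.map φ) := rfl

/-- The map `φ_* : D_A → D_A` induced on the group completion. -/
noncomputable def KriegerGroup.map (h : PosIrreducible A) (φ : AutShift A) :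
    KriegerGroup h →+ KriegerGroup h :=
  Algebra.GrothendieckAddGroup.lift (Algebra.GrothendieckAddGroup.of.comp (KriegerCone.map h φ))

lemma KriegerGroup.map_of (h : PosIrreducible A) (φ : AutShift A) (a : KriegerCone h) :
    KriegerGroup.map h φ (Algebra.GrothendieckAddGroup.of a) =
      Algebra.GrothendieckAddGroup.of (KriegerCone.map h φ a) := KriegerGroup.lift_of _ a

lemma KriegerGroup.map_one (h : PosIrreducible A) (x : KriegerGroup h) :
    KriegerGroup.map h 1 x = x := by
  have h1 : ∀ a, KriegerCone.map h 1 a = a := by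
    intro a
    obtain ⟨U, rfl⟩ := a.mk_surjective
    rw [KriegerCone.map_mk]
    congr 1
    exact Subtype.ext (image_id _)
  obtain ⟨a, b, rfl⟩ := KriegerGroup.exists_sub x
  rw [map_sub, KriegerGroup.map_of, KriegerGroup.map_of, h1, h1]

lemma KriegerGroup.map_mul (h : PosIrreducible A) (φ ψ : AutShift A) (x : KriegerGroup h) :
    KriegerGroup.map h (φ * ψ) x = KriegerGroup.map h φ (KriegerGroup.map h ψ x) := by
  have h1 : ∀ a, KriegerCone.map h (φ * ψ) a = KriegerCone.map h φ (KriegerCone.map h ψ a) := by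
    intro a
    obtain ⟨U, rfl⟩ := a.mk_surjective
    rw [KriegerCone.map_mk, KriegerCone.map_mk, KriegerCone.map_mk]
    congr 1
    exact Subtype.ext (image_comp φ.1 ψ.1 U.1)
  obtain ⟨a, b, rfl⟩ := KriegerGroup.exists_sub x
  simp only [map_sub, KriegerGroup.map_of, h1]

/-- The automorphism `φ_*` of `D_A`. -/
noncomputable def kriegerAut (h : PosIrreducible A) (φ : AutShift A) :
    KriegerGroup h ≃+ KriegerGroup h where
  toFun := KriegerGroup.map h φ
  invFun := KriegerGroup.map h φ⁻¹
  left_inv x := by rw [← KriegerGroup.map_mul, inv_mul_cancel, KriegerGroup.map_one]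
  right_inv x := by rw [← KriegerGroup.map_mul, mul_inv_cancel, KriegerGroup.map_one]
  map_add' := map_add _

/-- `S_φ = θ ∘ φ_* ∘ θ⁻¹`, the automorphism of `𝒢_A` with `S_φ ∘ θ = θ ∘ φ_*`. -/
noncomputable def dimAut (h : PosIrreducible A) (φ : AutShift A) : GroupAut (dimGroup A) :=
  (((theta h).symm.trans (kriegerAut h φ)).trans (theta h)).toIntLinearEquiv

lemma dimAut_theta (h : PosIrreducible A) (φ : AutShift A) (x : KriegerGroup h) :
    dimAut h φ (theta h x) = theta h (KriegerGroup.map h φ x) := by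
  change theta h (KriegerGroup.map h φ ((theta h).symm (theta h x))) = _
  rw [AddEquiv.symm_apply_apply]

lemma dimAut_mul (h : PosIrreducible A) (φ ψ : AutShift A) :
    dimAut h (φ * ψ) = dimAut h φ * dimAut h ψ := by
  ext1 x
  obtain ⟨x, rfl⟩ := (theta h).surjective x
  rw [LinearEquiv.mul_apply, dimAut_theta, dimAut_theta, dimAut_theta, KriegerGroup.map_mul]

/-- The shift, as an element of `Aut(σ_A)`. -/
def shiftAut (A : Matrix (Fin k) (Fin k) ℕ) : AutShift A :=
  ⟨shift A, Subgroup.mem_centralizer_singleton_iff.2 rfl⟩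

/-- `S_{σ_A} = δ_A`. -/
lemma dimAut_shiftAut (h : PosIrreducible A) : dimAut h (shiftAut A) = dimShift A := by
  ext1 x
  obtain ⟨x, rfl⟩ := (theta h).surjective x
  obtain ⟨a, b, rfl⟩ := KriegerGroup.exists_sub x
  have h1 : ∀ a : KriegerCone h, (KriegerCone.map h (shiftAut A) a).theta =
      dimShift A a.theta := by
    intro a
    obtain ⟨U, rfl⟩ := a.mk_surjective
    obtain ⟨m, hm⟩ := U.2
    have hray : ∀ x : EdgeShift A, (shift A) '' ray x m = ray (shift A x) (m - 1) := by
      intro x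
      have := image_zpow_ray 1 x m
      simpa using this
    have hinj : Function.Injective fun R : Set (EdgeShift A) => (shift A) '' R :=
      Set.image_injective.2 (shift A).injective
    have hb : IsBeam (U.map (shiftAut A)).1 (m - 1) := by
      obtain ⟨s, hs, hU⟩ := hm
      refine ⟨(shift A) '' s, hs.image _, ?_⟩
      change (shift A) '' U.1 = _
      rw [hU, image_iUnion₂, biUnion_image]
      simp only [hray]
    have hc : endCount (U.map (shiftAut A)).1 (m - 1) = endCount U.1 m := by
      funext J
      unfold endCount
      rw [← Set.ncard_image_of_injective (endRays U.1 m J) hinj]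
      congr 1
      have hlast : ∀ x : EdgeShift A, (shift A x).1 (m - 1) = x.1 m := fun x => by
        change x.1 (m - 1 + 1) = _
        rw [sub_add_cancel]
      ext R
      constructor
      · rintro ⟨_, ⟨x, hx, rfl⟩, hJ, rfl⟩
        refine ⟨_, ⟨x, hx, ?_, rfl⟩, hray x⟩
        rw [← hJ]; exact (congrArg Edge.tgt (hlast x)).symm
      · rintro ⟨_, ⟨x, hx, hJ, rfl⟩, rfl⟩
        exact ⟨_, ⟨x, hx, rfl⟩, (congrArg Edge.tgt (hlast x)).trans hJ, (hray x).symm⟩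
    rw [KriegerCone.map_mk, KriegerCone.theta_mk hb, hc, KriegerCone.theta_mk hm,
      ← LinearEquiv.mul_apply, ← zpow_one_add]
    congr 2; ring
  rw [dimAut_theta]
  simp only [map_sub, KriegerGroup.map_of, theta_of, h1]

lemma dimAut_mem (h : PosIrreducible A) (φ : AutShift A) : dimAut h φ ∈ DimAut A := by
  have key : ∀ φ : AutShift A, dimAut h φ '' (dimCone A : Set (dimGroup A)) ⊆ dimCone A := by
    rintro φ _ ⟨x, hx, rfl⟩
    rw [← KriegerCone.range_theta h] at hx ⊢
    obtain ⟨a, rfl⟩ := hx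
    refine ⟨KriegerCone.map h φ a, ?_⟩
    rw [← theta_of, ← theta_of, dimAut_theta, KriegerGroup.map_of]
  refine ⟨subset_antisymm (key φ) ?_, ?_⟩
  · intro x hx
    refine ⟨dimAut h φ⁻¹ x, key φ⁻¹ ⟨x, hx, rfl⟩, ?_⟩
    rw [← LinearEquiv.mul_apply, ← dimAut_mul, mul_inv_cancel]
    obtain ⟨x, rfl⟩ := (theta h).surjective x
    rw [dimAut_theta, KriegerGroup.map_one]
  · rw [← dimAut_shiftAut h, ← dimAut_mul, ← dimAut_mul]
    congr 1
    exact Subtype.ext (Subgroup.mem_centralizer_singleton_iff.1 φ.2)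

/-- The dimension representation `π_A : Aut(σ_A) → Aut(𝒢_A, 𝒢_A⁺, δ_A)`, `φ ↦ S_φ`. -/
noncomputable def dimensionRepresentation (h : PosIrreducible A) : AutShift A →* DimAut A :=
  MonoidHom.mk' (fun φ => ⟨dimAut h φ, dimAut_mem h φ⟩) fun φ ψ => Subtype.ext (dimAut_mul h φ ψ)

/-- An automorphism is inert if it lies in the kernel of the dimension representation. -/
def IsInert (h : PosIrreducible A) (φ : AutShift A) : Prop := φ ∈ (dimensionRepresentation h).ker

end SFT

/-!
Let `w > 0` be a Perron eigenvector of `A`, with `A w = l w`. Up to scalars, `x ↦ x ⬝ᵥ w` is the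
only homomorphism `𝒢_A → ℝ` that `δ_A` multiplies by `l`, so every automorphism of the dimension
triple rescales it, by a factor `s`, which is positive because the functional is positive on the
nonzero elements of the cone.

For the factor `s` of `π_A(φ)`, the image under `φ ^ n` of a `0`-ray has size about `s ^ n`, hence
meets at least about `s ^ n` distinct `0`-rays. Which of them a point of the original ray reaches
is determined by the central windows of its first `n` iterates, so `log s ≤ h_top(φ)`. The same
bound for `φ⁻¹`, which has the same entropy, gives `s = 1` when `h_top(φ) = 0`.

Then `π_A(φ)` preserves the functional, and it remains to see that the functional is injective on
`𝒢_A`. Its kernel in the eventual range is invariant under `A`. On the eventual range the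
characteristic polynomial of `A` is, up to a scalar, the reversal of the irreducible polynomial
`det (1 - t A)`, so the only invariant subspaces are `0` and everything, and the latter is excluded
by positivity.
-/

namespace SFT

open Set Topology Filter
open scoped Matrix

section Perron

lemma exists_gt_mul_le {ι : Type*} [Finite ι] [Nonempty ι] {r : ℝ} {x y : ι → ℝ}
    (hx : ∀ i, 0 < x i) (hxy : ∀ i, r * x i < y i) :
    ∃ r' > r, ∀ i, r' * x i ≤ y i := by
  obtain ⟨i₀, hi₀⟩ := Finite.exists_min fun i => y i / x i
  exact ⟨y i₀ / x i₀, (lt_div_iff₀ (hx i₀)).2 (hxy i₀), fun i => (le_div_iff₀ (hx i)).1 (hi₀ i)⟩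

variable {ι : Type*} [Fintype ι]

/-- A Perron pair of a real matrix: a positive eigenvalue together with an entrywise positive
eigenvector. -/
structure IsPerronPair (M : Matrix ι ι ℝ) (l : ℝ) (w : ι → ℝ) : Prop where
  eigenvalue_pos : 0 < l
  pos : ∀ i, 0 < w i
  mulVec_eq : M *ᵥ w = l • w

/-- The pairs `(r, x)` tested in the Collatz–Wielandt variational formula for the Perron
eigenvalue, with `x` normalised to the standard simplex to make the set compact. -/
def collatzWielandtSet (M : Matrix ι ι ℝ) : Set (ℝ × (ι → ℝ)) :=
  {p | 0 ≤ p.1 ∧ p.2 ∈ stdSimplex ℝ ι ∧ ∀ i, p.1 * p.2 i ≤ (M *ᵥ p.2) i}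

lemma mulVec_pos {M : Matrix ι ι ℝ} (hM : ∀ i j, 0 < M i j) {x : ι → ℝ} (hx : ∀ i, 0 ≤ x i)
    (hne : x ≠ 0) (i : ι) : 0 < (M *ᵥ x) i := by
  obtain ⟨j, hj⟩ := Function.ne_iff.1 hne
  exact Finset.sum_pos' (fun l _ => mul_nonneg (hM i l).le (hx l))
    ⟨j, Finset.mem_univ j, mul_pos (hM i j) (lt_of_le_of_ne (hx j) (Ne.symm hj))⟩

lemma isCompact_collatzWielandtSet {M : Matrix ι ι ℝ} (hM : ∀ i j, 0 ≤ M i j) :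
    IsCompact (collatzWielandtSet M) := by
  have hclosed : IsClosed (collatzWielandtSet M) := by
    have hle : IsClosed {p : ℝ × (ι → ℝ) | ∀ i, p.1 * p.2 i ≤ (M *ᵥ p.2) i} := by
      rw [Set.ofPred_forall]
      exact isClosed_iInter fun i => isClosed_le (by fun_prop) <|
        (continuous_apply i).comp (continuous_const.matrix_mulVec continuous_snd)
    exact (isClosed_le continuous_const continuous_fst).inter
      (((isClosed_stdSimplex ℝ ι).preimage continuous_snd).inter hle)
  refine IsCompact.of_isClosed_subset
    ((isCompact_Icc (a := 0) (b := ∑ i, ∑ j, M i j)).prod (isCompact_stdSimplex ℝ ι)) hclosed ?_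
  rintro ⟨r, x⟩ ⟨hr, hx, hrx⟩
  refine ⟨⟨hr, ?_⟩, hx⟩
  calc r = ∑ i, r * x i := by rw [← Finset.mul_sum, hx.2, mul_one]
    _ ≤ ∑ i, ∑ j, M i j * x j := Finset.sum_le_sum fun i _ => hrx i
    _ ≤ ∑ i, ∑ j, M i j := Finset.sum_le_sum fun i _ => Finset.sum_le_sum fun j _ =>
      mul_le_of_le_one_right (hM i j) (mem_Icc_of_mem_stdSimplex hx j).2

lemma exists_mem_collatzWielandtSet {M : Matrix ι ι ℝ} {r : ℝ} (hr : 0 ≤ r) {x : ι → ℝ}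
    (hx : ∀ i, 0 ≤ x i) (hne : x ≠ 0) (hrx : ∀ i, r * x i ≤ (M *ᵥ x) i) :
    ∃ y, (r, y) ∈ collatzWielandtSet M := by
  have hsum : 0 < ∑ i, x i := Fintype.sum_pos (lt_of_le_of_ne hx hne.symm)
  refine ⟨(∑ i, x i)⁻¹ • x, hr, ⟨fun i => mul_nonneg (inv_nonneg.2 hsum.le) (hx i), ?_⟩,
    fun i => ?_⟩
  · simp only [Pi.smul_apply, smul_eq_mul, ← Finset.mul_sum, inv_mul_cancel₀ hsum.ne']
  · simp only [Matrix.mulVec_smul, Pi.smul_apply, smul_eq_mul]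
    rw [mul_left_comm]
    exact mul_le_mul_of_nonneg_left (hrx i) (inv_nonneg.2 hsum.le)

lemma exists_pos_commute {M : Matrix ι ι ℝ} (hM : M.IsIrreducible) :
    ∃ B : Matrix ι ι ℝ, (∀ i j, 0 < B i j) ∧ Commute M B := by
  classical
  choose t _ ht using (Matrix.isIrreducible_iff_exists_pow_pos hM.nonneg).1 hM
  obtain ⟨b, hb⟩ := (Set.finite_range fun p : ι × ι => t p.1 p.2).bddAbove
  refine ⟨∑ s ∈ Finset.range (b + 1), M ^ s, fun i j => ?_,
    Commute.sum_right _ _ _ fun s _ => (Commute.refl M).pow_right s⟩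
  rw [Matrix.sum_apply]
  exact Finset.sum_pos' (fun s _ => Matrix.pow_apply_nonneg hM.nonneg s i j)
    ⟨t i j, Finset.mem_range.2 (Nat.lt_succ_of_le (hb ⟨(i, j), rfl⟩)), ht i j⟩

lemma pow_mulVec_eq [DecidableEq ι] {M : Matrix ι ι ℝ} {l : ℝ} {v : ι → ℝ} (h : M *ᵥ v = l • v)
    (t : ℕ) : (M ^ t) *ᵥ v = l ^ t • v := by
  induction t with
  | zero => rw [pow_zero, pow_zero, Matrix.one_mulVec, one_smul]
  | succ t ih => rw [pow_succ, ← Matrix.mulVec_mulVec, h, Matrix.mulVec_smul, ih, smul_smul,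
      pow_succ']

lemma IsPerronPair.of_nonneg {M : Matrix ι ι ℝ} (hM : M.IsIrreducible) {l : ℝ} {v : ι → ℝ}
    (hv : ∀ i, 0 ≤ v i) (hne : v ≠ 0) (h : M *ᵥ v = l • v) : IsPerronPair M l v := by
  classical
  obtain ⟨j, hj⟩ := Function.ne_iff.1 hne
  have hvj : 0 < v j := lt_of_le_of_ne (hv j) (Ne.symm hj)
  have hpos : ∀ i, ∃ t > 0, 0 < l ^ t * v i := fun i => by
    obtain ⟨t, ht, htij⟩ := (Matrix.isIrreducible_iff_exists_pow_pos hM.nonneg).1 hM i j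
    have hsum : 0 < ((M ^ t) *ᵥ v) i :=
      Finset.sum_pos' (fun m _ => mul_nonneg (Matrix.pow_apply_nonneg hM.nonneg t i m) (hv m))
        ⟨j, Finset.mem_univ j, mul_pos htij hvj⟩
    rw [pow_mulVec_eq h] at hsum
    exact ⟨t, ht, hsum⟩
  have hl : 0 ≤ l := by
    have hsum : 0 ≤ (M *ᵥ v) j := Finset.sum_nonneg fun m _ => mul_nonneg (hM.nonneg j m) (hv m)
    rw [h] at hsum
    exact nonneg_of_mul_nonneg_left hsum hvj
  refine ⟨lt_of_le_of_ne hl ?_, fun i => lt_of_le_of_ne (hv i) ?_, h⟩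
  · rintro rfl
    obtain ⟨t, ht, htj⟩ := hpos j
    rw [zero_pow ht.ne', zero_mul] at htj
    exact htj.false
  · obtain ⟨t, -, hti⟩ := hpos i
    exact (right_ne_zero_of_mul hti.ne').symm

theorem exists_isPerronPair [Nonempty ι] {M : Matrix ι ι ℝ} (hM : M.IsIrreducible) :
    ∃ l w, IsPerronPair M l w := by
  have hne : (collatzWielandtSet M).Nonempty := by
    obtain ⟨y, hy⟩ := exists_mem_collatzWielandtSet (M := M) (x := 1) le_rfl
      (fun _ => zero_le_one) one_ne_zero fun i => by
        rw [zero_mul]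
        exact Finset.sum_nonneg fun j _ => mul_nonneg (hM.nonneg i j) zero_le_one
    exact ⟨_, hy⟩
  obtain ⟨⟨r, x⟩, ⟨hr, hx, hrx⟩, hmax⟩ :=
    (isCompact_collatzWielandtSet hM.nonneg).exists_isMaxOn hne continuous_fst.continuousOn
  have hx0 : x ≠ 0 := by
    rintro rfl
    simpa using hx.2
  refine ⟨r, x, .of_nonneg hM hx.1 hx0 ?_⟩
  by_contra heq
  obtain ⟨B, hB, hMB⟩ := exists_pos_commute hM
  have hBx : ∀ i, 0 < (B *ᵥ x) i := mulVec_pos hB hx.1 hx0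
  have hlt : ∀ i, r * (B *ᵥ x) i < (M *ᵥ B *ᵥ x) i := fun i => by
    have hpos := mulVec_pos hB (x := M *ᵥ x - r • x) (fun i => sub_nonneg.2 (hrx i))
      (sub_ne_zero.2 heq) i
    rw [Matrix.mulVec_sub, Matrix.mulVec_smul, Matrix.mulVec_mulVec, ← hMB.eq,
      ← Matrix.mulVec_mulVec] at hpos
    exact sub_pos.1 hpos
  obtain ⟨r', hr', hle⟩ := exists_gt_mul_le hBx hlt
  obtain ⟨y, hy⟩ := exists_mem_collatzWielandtSet (hr.trans hr'.le) (fun i => (hBx i).le)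
    (fun h0 => (hBx (Classical.arbitrary ι)).ne' (congrFun h0 _)) hle
  exact (hmax hy).not_gt hr'

theorem IsPerronPair.exists_eq_smul [Nonempty ι] {M : Matrix ι ι ℝ} (hM : M.IsIrreducible)
    {l : ℝ} {v w : ι → ℝ} (hw : IsPerronPair M l w) (h : M *ᵥ v = l • v) :
    ∃ s : ℝ, v = s • w := by
  obtain ⟨i₀, hi₀⟩ := Finite.exists_min fun i => v i / w i
  refine ⟨v i₀ / w i₀, sub_eq_zero.1 ?_⟩
  by_contra hne
  have hnonneg : ∀ i, 0 ≤ (v - (v i₀ / w i₀) • w) i := fun i =>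
    sub_nonneg.2 ((le_div_iff₀ (hw.pos i)).1 (hi₀ i))
  have heig : M *ᵥ (v - (v i₀ / w i₀) • w) = l • (v - (v i₀ / w i₀) • w) := by
    rw [Matrix.mulVec_sub, Matrix.mulVec_smul, h, hw.mulVec_eq, smul_sub, smul_comm]
  refine ((IsPerronPair.of_nonneg hM hnonneg hne heig).pos i₀).ne' ?_
  rw [Pi.sub_apply, Pi.smul_apply, smul_eq_mul, div_mul_cancel₀ _ (hw.pos i₀).ne', sub_self]

end Perron

section InvariantSubspace

open Polynomial

lemma irreducible_of_irreducible_reverse {K : Type*} [Field K] {q : K[X]} (h0 : q.coeff 0 ≠ 0)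
    (h : Irreducible q.reverse) : Irreducible q := by
  have hunit : ∀ p : K[X], p.coeff 0 ≠ 0 → IsUnit p.reverse → IsUnit p := fun p hp hu => by
    have hdeg : p.reverse.natDegree = p.natDegree := by
      rw [reverse_natDegree, natTrailingDegree_eq_zero.2 (Or.inr hp), Nat.sub_zero]
    rw [natDegree_eq_zero_of_isUnit hu] at hdeg
    rw [eq_C_of_natDegree_eq_zero hdeg.symm]
    exact isUnit_C.2 (isUnit_iff_ne_zero.2 hp)
  refine ⟨fun hu => h.not_isUnit ?_, fun a b hab => ?_⟩
  · obtain ⟨c, -, rfl⟩ := isUnit_iff.1 hu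
    rw [reverse_C]
    exact hu
  · have hab0 : a.coeff 0 * b.coeff 0 ≠ 0 := by rwa [← mul_coeff_zero, ← hab]
    rw [hab, reverse_mul_of_domain] at h
    exact (h.isUnit_or_isUnit rfl).imp (hunit a (left_ne_zero_of_mul hab0))
      (hunit b (right_ne_zero_of_mul hab0))

lemma exists_eq_X_pow_mul_irreducible {K : Type*} [Field K] {p : K[X]}
    (h : Irreducible p.reverse) : ∃ q, p = X ^ p.natTrailingDegree * q ∧ Irreducible q := by
  have hp : p ≠ 0 := by
    rintro rfl
    exact h.ne_zero reverse_zero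
  obtain ⟨q, hpq, hq⟩ := exists_eq_pow_rootMultiplicity_mul_and_not_dvd p hp 0
  rw [rootMultiplicity_eq_natTrailingDegree', C_0, sub_zero] at hpq
  rw [C_0, sub_zero, X_dvd_iff] at hq
  refine ⟨q, hpq, irreducible_of_irreducible_reverse hq ?_⟩
  rwa [← reverse_X_pow_mul q p.natTrailingDegree, ← hpq]

variable {K V : Type*} [Field K] [AddCommGroup V] [Module K V]

lemma coe_aeval_restrict_apply {f : Module.End K V} {W : Submodule K V} (hW : ∀ x ∈ W, f x ∈ W)
    (p : K[X]) (x : W) : (aeval (f.restrict hW) p x : V) = aeval f p x := by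
  induction p using Polynomial.induction_on' with
  | add p q hp hq => simp only [map_add, LinearMap.add_apply, Submodule.coe_add, hp, hq]
  | monomial n c =>
    rw [aeval_monomial, aeval_monomial, Module.End.mul_apply, Module.End.mul_apply,
      Module.algebraMap_end_apply, Module.algebraMap_end_apply, Module.End.pow_restrict n,
      Submodule.coe_smul, LinearMap.coe_restrict_apply]

variable [FiniteDimensional K V]

lemma natDegree_le_finrank_of_aeval_eq_zero [Nontrivial V] {f : Module.End K V} {q : K[X]}
    (hq : Irreducible q) (hf : aeval f q = 0) : q.natDegree ≤ Module.finrank K V := by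
  have hassoc : Associated (minpoly K f) q :=
    (hq.dvd_iff.1 (minpoly.dvd K f hf)).resolve_left (minpoly.not_isUnit K f) |>.symm
  calc q.natDegree = (minpoly K f).natDegree := (natDegree_eq_of_degree_eq
        (degree_eq_degree_of_associated hassoc)).symm
    _ ≤ f.charpoly.natDegree :=
      natDegree_le_of_dvd (LinearMap.minpoly_dvd_charpoly f) f.charpoly_monic.ne_zero
    _ = Module.finrank K V := f.charpoly_natDegree

lemma finrank_range_pow_finrank_add_natTrailingDegree_charpoly (f : Module.End K V) :
    Module.finrank K (LinearMap.range (f ^ Module.finrank K V)) + f.charpoly.natTrailingDegree =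
      Module.finrank K V := by
  rw [← LinearMap.finrank_maxGenEigenspace_zero_eq,
    Module.End.maxGenEigenspace_eq_genEigenspace_finrank, Module.End.genEigenspace_nat, zero_smul,
    sub_zero, LinearMap.finrank_range_add_finrank_ker]

lemma injOn_range_pow_finrank (f : Module.End K V) :
    Set.InjOn f (LinearMap.range (f ^ Module.finrank K V)) := by
  rw [← LinearMap.disjoint_ker_iff_injOn, Submodule.disjoint_def]
  rintro _ ⟨y, rfl⟩ hy
  rw [LinearMap.mem_ker, ← Module.End.mul_apply, ← pow_succ'] at hy
  rw [← LinearMap.mem_ker,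
    ← Module.End.ker_pow_eq_ker_pow_finrank_of_le (Nat.le_succ (Module.finrank K V))]
  exact hy

theorem eq_range_pow_finrank_of_invariant {f : Module.End K V}
    (hf : Irreducible f.charpoly.reverse) {W : Submodule K V} (hW : ∀ x ∈ W, f x ∈ W)
    (hle : W ≤ LinearMap.range (f ^ Module.finrank K V)) (hne : W ≠ ⊥) :
    W = LinearMap.range (f ^ Module.finrank K V) := by
  obtain ⟨q, hpq, hq⟩ := exists_eq_X_pow_mul_irreducible hf
  let g : Module.End K W := f.restrict hW
  have hg : Function.Injective g :=
    fun x y hxy => Subtype.ext <| injOn_range_pow_finrank f (hle x.2) (hle y.2) <|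
      congrArg Subtype.val hxy
  have hgq : aeval g q = 0 := by
    have hchar : aeval g f.charpoly = 0 := LinearMap.ext fun x => Subtype.ext <| by
      rw [coe_aeval_restrict_apply, f.aeval_self_charpoly, LinearMap.zero_apply,
        LinearMap.zero_apply, Submodule.coe_zero]
    rw [hpq, map_mul, map_pow, aeval_X] at hchar
    refine LinearMap.ext fun x => (hg.iterate f.charpoly.natTrailingDegree) ?_
    rw [← Module.End.coe_pow, ← Module.End.mul_apply, hchar, LinearMap.zero_apply,
      map_zero]
  have : Nontrivial W := Submodule.nontrivial_iff_ne_bot.2 hne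
  refine Submodule.eq_of_le_of_finrank_le hle ?_
  have hdeg := congrArg natDegree hpq
  rw [f.charpoly_natDegree, natDegree_mul (pow_ne_zero _ X_ne_zero) hq.ne_zero,
    natDegree_X_pow] at hdeg
  have hrange := finrank_range_pow_finrank_add_natTrailingDegree_charpoly f
  have hqW := natDegree_le_finrank_of_aeval_eq_zero hq hgq
  lia

end InvariantSubspace

variable {k : ℕ} {A : Matrix (Fin k) (Fin k) ℕ}

/-- The matrix `A` with entries in `ℝ`, in which its Perron eigenvector lives. -/
abbrev realMatrix (A : Matrix (Fin k) (Fin k) ℕ) : Matrix (Fin k) (Fin k) ℝ :=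
  A.map (Nat.cast : ℕ → ℝ)

/-- The functional `x ↦ ∑ i, x i * w i` on `𝒢_A`. For a Perron eigenvector `w` it measures the
size of a beam through its class in `𝒢_A`. -/
noncomputable def dimFunctional (w : Fin k → ℝ) : dimGroup A →+ ℝ :=
  (Fintype.linearCombination ℚ w).toAddMonoidHom.comp (dimGroup A).subtype

lemma PosIrreducible.isIrreducible_realMatrix (h : PosIrreducible A) :
    (realMatrix A).IsIrreducible := by
  refine (Matrix.isIrreducible_iff_exists_pow_pos (A := realMatrix A) fun i j =>
    Nat.cast_nonneg (A i j)).2 fun i j => (h.exists_pow_pos i j).imp fun t ht => ⟨ht.1, ?_⟩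
  have hpow : realMatrix A ^ t = realMatrix (A ^ t) :=
    (map_pow (Nat.castRingHom ℝ).mapMatrix A t).symm
  rw [hpow]
  exact Nat.cast_pos.2 ht.2

lemma ofVec_eq_sum (v : Fin k → ℕ) : ofVec A v = ∑ J, v J • ofVec A (Pi.single J 1) := by
  let φ : (Fin k → ℕ) →+ dimGroup A := ⟨⟨ofVec A, ofVec_zero⟩, ofVec_add⟩
  calc ofVec A v = φ (∑ J, v J • Pi.single J 1) := by
        simp only [← Pi.single_smul', smul_eq_mul, mul_one, Finset.univ_sum_single]; rfl
    _ = ∑ J, v J • ofVec A (Pi.single J 1) := by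
        simp only [map_sum, map_nsmul]; rfl

lemma exists_dimShift_pow_eq_ofVec {x : dimGroup A} (hx : x ∈ dimCone A) :
    ∃ m u, (dimShift A ^ m) x = ofVec A u := by
  obtain ⟨m, u, hu⟩ := hx
  refine ⟨k + m, u, Subtype.ext ?_⟩
  rw [coe_dimShift_pow, add_comm, pow_add, ← Matrix.vecMul_vecMul, hu, coe_ofVec]

lemma ofVec_mem_dimCone (v : Fin k → ℕ) : ofVec A v ∈ dimCone A :=
  ⟨0, Matrix.vecMul v (A ^ k), by rw [cast_vecMul, pow_zero, Matrix.vecMul_one, coe_ofVec]⟩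

section Eigenfunctional

variable {G : Type*} [AddCommGroup G] {g : G →+ ℝ} {Φ : GroupAut G} {s : ℝ}

lemma map_zpow_apply_eq_mul (hs : s ≠ 0) (hg : ∀ x, g (Φ x) = s * g x) (n : ℤ) (x : G) :
    g ((Φ ^ n) x) = s ^ n * g x := by
  induction n generalizing x with
  | zero => rw [zpow_zero, zpow_zero, one_mul, LinearEquiv.coe_one, id]
  | succ n ih => rw [zpow_add_one, LinearEquiv.mul_apply, ih, hg, zpow_add_one₀ hs, mul_assoc]
  | pred n ih =>
    have hΦ := hg ((Φ ^ (-(n : ℤ) - 1)) x)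
    rw [← LinearEquiv.mul_apply, ← zpow_one_add, add_sub_cancel, ih] at hΦ
    rw [zpow_sub_one₀ hs, mul_right_comm, hΦ, mul_comm s, mul_inv_cancel_right₀ hs]

end Eigenfunctional

lemma eq_of_eqOn_ofVec {g g' : dimGroup A →+ ℝ} {l : ℝ} (hl : l ≠ 0)
    (hg : ∀ x, g (dimShift A x) = l * g x) (hg' : ∀ x, g' (dimShift A x) = l * g' x)
    (h : ∀ J, g (ofVec A (Pi.single J 1)) = g' (ofVec A (Pi.single J 1))) : g = g' := by
  have hvec : ∀ u, g (ofVec A u) = g' (ofVec A u) := fun u => by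
    simp only [ofVec_eq_sum u, map_sum, map_nsmul, h]
  have hcone : ∀ x ∈ dimCone A, g x = g' x := fun x hx => by
    obtain ⟨m, u, hu⟩ := exists_dimShift_pow_eq_ofVec hx
    have hpow := hvec u
    rw [← hu, ← zpow_natCast, map_zpow_apply_eq_mul hl hg, map_zpow_apply_eq_mul hl hg'] at hpow
    exact mul_left_cancel₀ (zpow_ne_zero _ hl) hpow
  ext x
  obtain ⟨a, ha, b, hb, rfl⟩ := dimGroup_eq_sub x
  rw [map_sub, map_sub, hcone a ha, hcone b hb]

lemma eventualRange_eq_of_invariant (hdet : Irreducible (ratMatrix A).charpolyRev)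
    {W : Submodule ℚ (Fin k → ℚ)} (hW : ∀ x ∈ W, Matrix.vecMul x (ratMatrix A) ∈ W)
    (hle : W ≤ eventualRange A) (hne : W ≠ ⊥) : W = eventualRange A := by
  have hrange : eventualRange A = LinearMap.range
      ((ratMatrix A).vecMulLinear ^ Module.finrank ℚ (Fin k → ℚ)) := by
    rw [Module.finrank_fin_fun, vecMulLinear_pow]; rfl
  have hirr : Irreducible (ratMatrix A).vecMulLinear.charpoly.reverse := by
    rwa [← Matrix.mulVecLin_transpose, ← Matrix.toLin'_apply', Matrix.charpoly_toLin',
      Matrix.charpoly_transpose, Matrix.reverse_charpoly]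
  rw [hrange] at hle ⊢
  exact eq_range_pow_finrank_of_invariant hirr hW hle hne

namespace IsPerronPair

variable {l : ℝ} {w : Fin k → ℝ}

lemma linearCombination_vecMul (hw : IsPerronPair (realMatrix A) l w) (x : Fin k → ℚ) :
    Fintype.linearCombination ℚ w (Matrix.vecMul x (ratMatrix A)) =
      l * Fintype.linearCombination ℚ w x := by
  have hdot : ∀ y : Fin k → ℚ, Fintype.linearCombination ℚ w y = (fun i => (y i : ℝ)) ⬝ᵥ w :=
    fun y => by simp only [Fintype.linearCombination_apply, dotProduct, Rat.smul_def]
  have hcast : (fun i => ((Matrix.vecMul x (ratMatrix A) i : ℚ) : ℝ)) =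
      Matrix.vecMul (fun i => (x i : ℝ)) (realMatrix A) := by
    funext i
    simp only [Matrix.vecMul, dotProduct, Matrix.map_apply, Rat.cast_sum, Rat.cast_mul,
      Rat.cast_natCast]
  rw [hdot, hcast, ← Matrix.dotProduct_mulVec, hw.mulVec_eq, dotProduct_smul, hdot, smul_eq_mul]

lemma dimFunctional_dimShift (hw : IsPerronPair (realMatrix A) l w) (x : dimGroup A) :
    dimFunctional w (dimShift A x) = l * dimFunctional w x :=
  hw.linearCombination_vecMul x.1

lemma dimFunctional_ofVec (hw : IsPerronPair (realMatrix A) l w) (v : Fin k → ℕ) :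
    dimFunctional w (ofVec A v) = l ^ k * ∑ J, v J * w J := by
  have hpow : ∀ (n : ℕ) (x : Fin k → ℚ),
      Fintype.linearCombination ℚ w (Matrix.vecMul x (ratMatrix A ^ n)) =
        l ^ n * Fintype.linearCombination ℚ w x := fun n x => by
    induction n with
    | zero => rw [pow_zero, pow_zero, Matrix.vecMul_one, one_mul]
    | succ n ih =>
      rw [pow_succ, ← Matrix.vecMul_vecMul, hw.linearCombination_vecMul, ih, pow_succ', mul_assoc]
  refine (hpow k _).trans ?_
  simp only [Fintype.linearCombination_apply, Rat.smul_def, Rat.cast_natCast]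

lemma dimFunctional_thetaAt (hw : IsPerronPair (realMatrix A) l w) (U : Set (EdgeShift A))
    (n : ℤ) : dimFunctional w (thetaAt U n) = l ^ (-n) * ∑ J, endCount U n J * w J := by
  rw [thetaAt, map_zpow_apply_eq_mul hw.eigenvalue_pos.ne' hw.dimFunctional_dimShift,
    hw.dimFunctional_ofVec, ← mul_assoc, ← zpow_natCast, ← zpow_add₀ hw.eigenvalue_pos.ne',
    sub_add_eq_add_sub, neg_add_cancel, zero_sub]

lemma dimFunctional_pos (hw : IsPerronPair (realMatrix A) l w) {x : dimGroup A}
    (hx : x ∈ dimCone A) (hne : x ≠ 0) : 0 < dimFunctional w x := by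
  obtain ⟨m, u, hu⟩ := exists_dimShift_pow_eq_ofVec hx
  have hu0 : u ≠ 0 := by
    rintro rfl
    rw [ofVec_zero, LinearEquiv.map_eq_zero_iff] at hu
    exact hne hu
  obtain ⟨J, hJ⟩ := Function.ne_iff.1 hu0
  have hsum : 0 < ∑ J, u J * w J :=
    Finset.sum_pos' (fun J _ => mul_nonneg (Nat.cast_nonneg _) (hw.pos J).le)
      ⟨J, Finset.mem_univ J, mul_pos (Nat.cast_pos.2 (Nat.pos_of_ne_zero hJ)) (hw.pos J)⟩
  have hpow := map_zpow_apply_eq_mul hw.eigenvalue_pos.ne' hw.dimFunctional_dimShift m x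
  rw [zpow_natCast, zpow_natCast, hu, hw.dimFunctional_ofVec] at hpow
  refine pos_of_mul_pos_right ?_ (pow_pos hw.eigenvalue_pos m).le
  rw [← hpow]
  exact mul_pos (pow_pos hw.eigenvalue_pos k) hsum

theorem exists_eq_mul_dimFunctional [Nonempty (Fin k)] (hA : (realMatrix A).IsIrreducible)
    (hw : IsPerronPair (realMatrix A) l w) {g : dimGroup A →+ ℝ}
    (hg : ∀ x, g (dimShift A x) = l * g x) : ∃ s, ∀ x, g x = s * dimFunctional w x := by
  have heig : realMatrix A *ᵥ (fun J => g (ofVec A (Pi.single J 1))) =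
      l • fun J => g (ofVec A (Pi.single J 1)) := by
    funext I
    calc (realMatrix A *ᵥ fun J => g (ofVec A (Pi.single J 1))) I
        = g (∑ J, A I J • ofVec A (Pi.single J 1)) := by
          simp only [map_sum, map_nsmul, nsmul_eq_mul]; rfl
      _ = g (ofVec A (Matrix.vecMul (Pi.single I 1) (A ^ 1))) := by
          rw [pow_one, Matrix.single_one_vecMul, ofVec_eq_sum]; rfl
      _ = l * g (ofVec A (Pi.single I 1)) := by rw [ofVec_vecMul, pow_one, hg]
  obtain ⟨s, hs⟩ := hw.exists_eq_smul hA heig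
  have hl := hw.eigenvalue_pos.ne'
  refine ⟨s / l ^ k, DFunLike.congr_fun (eq_of_eqOn_ofVec hl hg
    (g' := (AddMonoidHom.mulLeft (s / l ^ k)).comp (dimFunctional w)) (fun x => ?_) fun J => ?_)⟩
  · simp only [AddMonoidHom.comp_apply, AddMonoidHom.coe_mulLeft, hw.dimFunctional_dimShift]
    ring
  · have hJ : dimFunctional w (ofVec A (Pi.single J 1)) = l ^ k * w J := by
      simp only [hw.dimFunctional_ofVec, Pi.single_apply, Nat.cast_ite, Nat.cast_one,
        Nat.cast_zero, ite_mul, one_mul, zero_mul, Finset.sum_ite_eq', Finset.mem_univ, if_true]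
    rw [AddMonoidHom.comp_apply, AddMonoidHom.coe_mulLeft, hJ, ← mul_assoc,
      div_mul_cancel₀ _ (pow_ne_zero k hl)]
    exact congrFun hs J

lemma dimFunctional_ofVec_one_pos [Nonempty (Fin k)] (hw : IsPerronPair (realMatrix A) l w) :
    0 < dimFunctional w (ofVec A 1) := by
  rw [hw.dimFunctional_ofVec]
  refine mul_pos (pow_pos hw.eigenvalue_pos k) (Finset.sum_pos (fun J _ => ?_)
    Finset.univ_nonempty)
  rw [Pi.one_apply, Nat.cast_one, one_mul]
  exact hw.pos J

theorem exists_pos_dimFunctional_apply_eq_mul [Nonempty (Fin k)]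
    (hA : (realMatrix A).IsIrreducible) (hw : IsPerronPair (realMatrix A) l w)
    {Φ : GroupAut (dimGroup A)} (hΦ : Φ ∈ DimAut A) :
    ∃ s > 0, ∀ x, dimFunctional w (Φ x) = s * dimFunctional w x := by
  have hcomm : ∀ x, dimFunctional w (Φ (dimShift A x)) = l * dimFunctional w (Φ x) := fun x => by
    rw [← LinearEquiv.mul_apply, hΦ.2, LinearEquiv.mul_apply, hw.dimFunctional_dimShift]
  obtain ⟨s, hs⟩ := hw.exists_eq_mul_dimFunctional hA
    (g := (dimFunctional w).comp Φ.toLinearMap.toAddMonoidHom) hcomm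
  have hpos := hw.dimFunctional_ofVec_one_pos
  have hmem : Φ (ofVec A 1) ∈ dimCone A := by
    rw [← SetLike.mem_coe, ← hΦ.1]
    exact mem_image_of_mem Φ (ofVec_mem_dimCone 1)
  have hne : Φ (ofVec A 1) ≠ 0 := fun h0 => by
    rw [Φ.map_eq_zero_iff.1 h0, map_zero] at hpos
    exact hpos.false
  refine ⟨s, pos_of_mul_pos_left ?_ hpos.le, hs⟩
  rw [← hs]
  exact hw.dimFunctional_pos hmem hne

lemma dimFunctional_injective [Nonempty (Fin k)] (hw : IsPerronPair (realMatrix A) l w)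
    (hdet : Irreducible (ratMatrix A).charpolyRev) :
    Function.Injective (dimFunctional w : dimGroup A →+ ℝ) := by
  refine (injective_iff_map_eq_zero _).2 fun x hx => ?_
  by_contra hne
  let W := eventualRange A ⊓ LinearMap.ker (Fintype.linearCombination ℚ w)
  have hWne : W ≠ ⊥ := fun h => hne <| Subtype.ext <| (Submodule.mem_bot ℚ).1 <|
    h ▸ Submodule.mem_inf.2 ⟨x.2.1, hx⟩
  have hW : ∀ y ∈ W, Matrix.vecMul y (ratMatrix A) ∈ W := fun y hy => by
    refine ⟨vecMul_mem_eventualRange hy.1, ?_⟩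
    rw [SetLike.mem_coe, LinearMap.mem_ker, hw.linearCombination_vecMul,
      LinearMap.mem_ker.1 hy.2, mul_zero]
  have hone : (ofVec A 1).1 ∈ W :=
    eventualRange_eq_of_invariant hdet hW inf_le_left hWne ▸ (ofVec A 1).2.1
  exact hw.dimFunctional_ofVec_one_pos.ne' hone.2

end IsPerronPair

section Entropy

variable {X : Type*}

lemma coverMincard_le_coverMincard_symm (e : X ≃ X) (U : SetRel X X) (n : ℕ) :
    Dynamics.coverMincard e univ U n ≤ Dynamics.coverMincard e.symm univ U n := by
  classical
  refine le_iInf₂ fun s hs => ?_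
  have himage : Dynamics.IsDynCoverOf e univ U n (s.image e.symm^[n - 1]) := fun x _ => by
    obtain ⟨y, hy, hxy⟩ := hs (mem_univ (e^[n - 1] x))
    refine ⟨e.symm^[n - 1] y, Finset.mem_coe.2 (Finset.mem_image_of_mem _ hy),
      Dynamics.mem_dynEntourage.2 fun j hj => ?_⟩
    obtain ⟨d, hd⟩ : ∃ d, n - 1 = j + d := ⟨n - 1 - j, by omega⟩
    have hforth : ∀ z, e.symm^[d] (e^[n - 1] z) = e^[j] z := fun z => by
      rw [hd, add_comm, Function.iterate_add_apply, e.leftInverse_symm.iterate d]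
    have hback : ∀ z, e^[j] (e.symm^[n - 1] z) = e.symm^[d] z := fun z => by
      rw [hd, Function.iterate_add_apply, e.rightInverse_symm.iterate j]
    rw [← hforth, hback]
    exact Dynamics.mem_dynEntourage.1 hxy d (by omega)
  exact himage.coverMincard_le_card.trans (by exact_mod_cast Finset.card_image_le)

theorem topEntropy_symm [UniformSpace X] (e : X ≃ X) : topEntropy e.symm = topEntropy e := by
  have hle : ∀ f : X ≃ X, topEntropy f ≤ topEntropy f.symm := fun f =>
    iSup₂_mono fun U _ => ExpGrowth.expGrowthSup_monotone fun n =>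
      ENat.toENNReal_mono (coverMincard_le_coverMincard_symm f U n)
  exact le_antisymm (hle e.symm) (hle e)

lemma log_le_topEntropy_of_mul_pow_le_netMaxcard [UniformSpace X] {T : X → X} {U : SetRel X X}
    (hU : U ∈ uniformity X) {c s : ENNReal} (hc : c ≠ 0)
    (h : ∀ n, c * s ^ n ≤ Dynamics.netMaxcard T univ U n) : ENNReal.log s ≤ topEntropy T :=
  calc ENNReal.log s = ExpGrowth.expGrowthSup (s ^ ·) := ExpGrowth.expGrowthSup_pow.symm
    _ ≤ Dynamics.netEntropyEntourage T univ U :=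
      ExpGrowth.expGrowthSup_of_eventually_ge hc (Eventually.of_forall h)
    _ ≤ topEntropy T := Dynamics.netEntropyEntourage_le_coverEntropy _ _ hU

end Entropy

/-- The entourage of pairs of points that agree on the coordinates `-N, …, N`. -/
def window (A : Matrix (Fin k) (Fin k) ℕ) (N : ℕ) : SetRel (EdgeShift A) (EdgeShift A) :=
  {p | ∀ i : ℤ, -N ≤ i → i ≤ N → p.1.1 i = p.2.1 i}

lemma window_mem_uniformity (N : ℕ) : window A N ∈ uniformity (EdgeShift A) := by
  have hcoord : ∀ i : ℤ, {p : EdgeShift A × EdgeShift A | p.1.1 i = p.2.1 i} ∈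
      uniformity (EdgeShift A) := fun i => by
    have hproj : UniformContinuous fun x : EdgeShift A => x.1 i :=
      (Pi.uniformContinuous_proj _ i).comp uniformContinuous_subtype_val
    exact hproj (DiscreteUniformity.relId_mem_uniformity (Edge A))
  refine mem_of_superset ((biInter_mem (finite_Icc (-N : ℤ) N)).2 fun i _ => hcoord i) ?_
  exact fun p hp i hi hi' => mem_iInter₂.1 hp i ⟨hi, hi'⟩

lemma IsBeam.exists_isBeam_image (φ : AutShift A) {U : Set (EdgeShift A)} {m : ℤ}
    (hU : IsBeam U m) : ∃ n ≥ m, IsBeam (φ.1 '' U) n := by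
  obtain ⟨N, hN, hN'⟩ := AutShift.exists_window₂ φ
  exact ⟨m + N, by omega, hU.image_aut φ hN hN'⟩

lemma IsBeam.finite_image_ray {V : Set (EdgeShift A)} {m n : ℤ} (hV : IsBeam V m) (hnm : n ≤ m) :
    ((fun y => ray y n) '' V).Finite := by
  obtain ⟨t, -, ht, hte⟩ := exists_finite_reps (isBeam_iff.1 hV).2
  refine (ht.image fun y => ray y n).subset ?_
  rintro _ ⟨y, hy, rfl⟩
  obtain ⟨z, hz, hzy⟩ : ray y m ∈ (fun x => ray x m) '' t := hte ▸ ⟨y, hy, rfl⟩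
  exact ⟨z, hz, ray_eq_iff.2 fun i hi => ray_eq_iff.1 hzy i (hi.trans hnm)⟩

lemma isBeam_coarsen {V : Set (EdgeShift A)} {n : ℤ} (hV : ((fun y => ray y n) '' V).Finite) :
    IsBeam (coarsen n V) n := by
  obtain ⟨t, -, ht, hte⟩ := exists_finite_reps hV
  exact ⟨t, ht, by rw [coarsen, ← sUnion_image, ← hte, sUnion_image]⟩

lemma subset_coarsen (V : Set (EdgeShift A)) (n : ℤ) : V ⊆ coarsen n V :=
  fun y hy => mem_iUnion₂.2 ⟨y, hy, fun _ _ => rfl⟩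

lemma endCount_mono {U V : Set (EdgeShift A)} {m : ℤ} (hUV : U ⊆ V) (hV : IsBeam V m)
    (J : Fin k) : endCount U m J ≤ endCount V m J := by
  refine ncard_le_ncard ?_ (endRays_finite hV J)
  rintro _ ⟨y, hy, hJ, rfl⟩
  exact ⟨y, hUV hy, hJ, rfl⟩

lemma endCount_coarsen_le {V : Set (EdgeShift A)} {n : ℤ}
    (hV : ((fun y => ray y n) '' V).Finite) (J : Fin k) :
    endCount (coarsen n V) n J ≤ ((fun y => ray y n) '' V).ncard := by
  refine ncard_le_ncard ?_ hV
  rintro _ ⟨y, hy, -, rfl⟩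
  obtain ⟨z, hz, hyz⟩ := mem_iUnion₂.1 hy
  exact ⟨z, hz, (ray_eq_iff.2 hyz).symm⟩

namespace AutShift

lemma coe_pow (φ : AutShift A) (n : ℕ) : ⇑(φ ^ n).1 = φ.1^[n] :=
  hom_coe_pow (fun ψ : AutShift A => ⇑ψ.1) rfl (fun _ _ => rfl) φ n

-- The coordinates up to `0` of `φ x` depend on those up to `N` of `x`; the window supplies the
-- missing coordinates `1, …, N` at each step.
lemma ray_iterate_eq {φ : AutShift A} {N : ℕ} (hN : ∀ (x y : EdgeShift A) (m : ℤ),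
    (∀ i : ℤ, m - N ≤ i → i ≤ m + N → x.1 i = y.1 i) → (φ.1 x).1 m = (φ.1 y).1 m)
    {u v : EdgeShift A} (huv : ray u 0 = ray v 0) {n : ℕ}
    (h : ∀ j < n, (φ.1^[j] u, φ.1^[j] v) ∈ window A N) :
    ray (φ.1^[n] u) 0 = ray (φ.1^[n] v) 0 := by
  induction n with
  | zero => exact huv
  | succ n ih =>
    have hpast := ray_eq_iff.1 (ih fun j hj => h j (by omega))
    refine ray_eq_iff.2 fun m hm => ?_
    rw [Function.iterate_succ_apply', Function.iterate_succ_apply']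
    refine hN _ _ _ fun i _ hi' => ?_
    rcases le_or_gt i 0 with hi0 | hi0
    · exact hpast i hi0
    · exact h n n.lt_succ_self i (by omega) (by omega)

lemma ncard_image_ray_le_netMaxcard {φ : AutShift A} {N : ℕ}
    (hN : ∀ (x y : EdgeShift A) (m : ℤ),
      (∀ i : ℤ, m - N ≤ i → i ≤ m + N → x.1 i = y.1 i) → (φ.1 x).1 m = (φ.1 y).1 m)
    (x : EdgeShift A) (n : ℕ) :
    (((fun y => ray y 0) '' ((φ ^ n).1 '' ray x 0)).ncard : ℕ∞) ≤
      Dynamics.netMaxcard φ.1 univ (window A N) n := by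
  rw [image_image, coe_pow]
  obtain ⟨T, hTx, hT⟩ := exists_subset_bijOn (ray x 0) fun y => ray (φ.1^[n] y) 0
  rw [← hT.image_eq, hT.injOn.ncard_image]
  rcases T.finite_or_infinite with hfin | hinf
  · obtain ⟨t, rfl⟩ := hfin.exists_finset_coe
    rw [ncard_coe_finset]
    refine Dynamics.IsDynNetIn.card_le_netMaxcard ⟨subset_univ _, fun u hu v hv huv => ?_⟩
    refine disjoint_left.2 fun z hzu hzv => huv (hT.injOn hu hv ?_)
    refine ray_iterate_eq hN ((ray_eq_iff.2 (hTx hu)).trans (ray_eq_iff.2 (hTx hv)).symm)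
      fun j hj i hi hi' => ?_
    exact (Dynamics.mem_ball_dynEntourage.1 hzu j hj i hi hi').trans
      (Dynamics.mem_ball_dynEntourage.1 hzv j hj i hi hi').symm
  · rw [hinf.ncard, Nat.cast_zero]
    exact zero_le

end AutShift

lemma dimAut_thetaAt (h : PosIrreducible A) (φ : AutShift A) {U : Set (EdgeShift A)} {m n : ℤ}
    (hU : IsBeam U n) (hV : IsBeam (φ.1 '' U) m) :
    dimAut h φ (thetaAt U n) = thetaAt (φ.1 '' U) m := by
  let B : Beam A := ⟨U, n, hU⟩
  have hB : thetaAt U n = theta h (Algebra.GrothendieckAddGroup.of (KriegerCone.mk h B)) :=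
    (KriegerCone.theta_mk (U := B) hU).symm.trans (theta_of h _).symm
  rw [hB, dimAut_theta, KriegerGroup.map_of, theta_of, KriegerCone.map_mk]
  exact KriegerCone.theta_mk (U := B.map φ) hV

lemma dimAut_zpow (h : PosIrreducible A) (φ : AutShift A) (n : ℤ) :
    dimAut h (φ ^ n) = dimAut h φ ^ n :=
  congrArg Subtype.val (map_zpow (dimensionRepresentation h) φ n)

lemma dimFunctional_dimAut_zpow (h : PosIrreducible A) {w : Fin k → ℝ} {φ : AutShift A} {s : ℝ}
    (hs0 : s ≠ 0)
    (hs : ∀ x, dimFunctional w (dimAut h φ x) = s * dimFunctional w x)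
    (n : ℤ) (x : dimGroup A) :
    dimFunctional w (dimAut h (φ ^ n) x) = s ^ n * dimFunctional w x := by
  rw [dimAut_zpow, map_zpow_apply_eq_mul hs0 hs]

lemma PosIrreducible.nonempty (h : PosIrreducible A) : Nonempty (EdgeShift A) := by
  by_contra hempty
  rw [not_nonempty_iff] at hempty
  have hbot : topEntropy (shift A) = ⊥ := by
    rw [topEntropy, univ_eq_empty_iff.2 hempty, Dynamics.coverEntropy_empty]
  exact not_lt_bot (hbot ▸ h.entropy_pos)

lemma isBeam_ray (x : EdgeShift A) (m : ℤ) : IsBeam (ray x m) m :=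
  ⟨{x}, finite_singleton x, by rw [biUnion_singleton]⟩

namespace IsPerronPair

variable {l : ℝ} {w : Fin k → ℝ}

lemma dimFunctional_thetaAt_mono (hw : IsPerronPair (realMatrix A) l w)
    {U V : Set (EdgeShift A)} {m : ℤ} (hUV : U ⊆ V) (hV : IsBeam V m) :
    dimFunctional w (thetaAt U m) ≤ dimFunctional w (thetaAt V m) := by
  rw [hw.dimFunctional_thetaAt, hw.dimFunctional_thetaAt]
  refine mul_le_mul_of_nonneg_left (Finset.sum_le_sum fun J _ => ?_)
    (zpow_pos hw.eigenvalue_pos _).le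
  exact mul_le_mul_of_nonneg_right (Nat.cast_le.2 (endCount_mono hUV hV J)) (hw.pos J).le

lemma dimFunctional_thetaAt_le (hw : IsPerronPair (realMatrix A) l w) (h : PosIrreducible A)
    {V : Set (EdgeShift A)} {m n : ℤ} (hV : IsBeam V m) (hnm : n ≤ m) :
    dimFunctional w (thetaAt V m) ≤
      l ^ (-n) * (((fun y => ray y n) '' V).ncard * ∑ J, w J) := by
  have hfin := hV.finite_image_ray hnm
  have hbeam := isBeam_coarsen hfin
  calc dimFunctional w (thetaAt V m) ≤ dimFunctional w (thetaAt (coarsen n V) m) :=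
        hw.dimFunctional_thetaAt_mono (subset_coarsen V n) (hbeam.mono hnm)
    _ = l ^ (-n) * ∑ J, endCount (coarsen n V) n J * w J := by
        rw [thetaAt_mono h hbeam hnm, hw.dimFunctional_thetaAt]
    _ ≤ l ^ (-n) * (((fun y => ray y n) '' V).ncard * ∑ J, w J) := by
        rw [Finset.mul_sum _ _ (Nat.cast _)]
        refine mul_le_mul_of_nonneg_left (Finset.sum_le_sum fun J _ => ?_)
          (zpow_pos hw.eigenvalue_pos _).le
        exact mul_le_mul_of_nonneg_right (Nat.cast_le.2 (endCount_coarsen_le hfin J)) (hw.pos J).le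

lemma dimFunctional_thetaAt_ray_pos (hw : IsPerronPair (realMatrix A) l w) (x : EdgeShift A)
    (m : ℤ) : 0 < dimFunctional w (thetaAt (ray x m) m) := by
  rw [hw.dimFunctional_thetaAt]
  have hcount : 0 < endCount (ray x m) m (x.1 m).tgt :=
    (ncard_pos (endRays_finite (isBeam_ray x m) _)).2 ⟨_, x, fun _ _ => rfl, rfl, rfl⟩
  exact mul_pos (zpow_pos hw.eigenvalue_pos _) <|
    Finset.sum_pos' (fun J _ => mul_nonneg (Nat.cast_nonneg _) (hw.pos J).le)
      ⟨_, Finset.mem_univ _, mul_pos (Nat.cast_pos.2 hcount) (hw.pos _)⟩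

lemma pow_mul_le_ncard_mul (hw : IsPerronPair (realMatrix A) l w) (h : PosIrreducible A)
    {φ : AutShift A} {s : ℝ} (hs0 : s ≠ 0)
    (hs : ∀ x, dimFunctional w (dimAut h φ x) = s * dimFunctional w x)
    (x : EdgeShift A) (n : ℕ) :
    s ^ n * dimFunctional w (thetaAt (ray x 0) 0) ≤
      ((fun y => ray y 0) '' ((φ ^ n).1 '' ray x 0)).ncard * ∑ J, w J := by
  obtain ⟨m, hm, hbeam⟩ := (isBeam_ray x 0).exists_isBeam_image (φ ^ n)
  calc s ^ n * dimFunctional w (thetaAt (ray x 0) 0)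
      = dimFunctional w (dimAut h (φ ^ n) (thetaAt (ray x 0) 0)) := by
        rw [← zpow_natCast φ, dimFunctional_dimAut_zpow h hs0 hs, zpow_natCast]
    _ = dimFunctional w (thetaAt ((φ ^ n).1 '' ray x 0) m) := by
        rw [dimAut_thetaAt h _ (isBeam_ray x 0) hbeam]
    _ ≤ _ := by
        simpa only [neg_zero, zpow_zero, one_mul] using hw.dimFunctional_thetaAt_le h hbeam hm

theorem log_le_topEntropy (hw : IsPerronPair (realMatrix A) l w) (h : PosIrreducible A)
    {φ : AutShift A} {s : ℝ} (hs0 : 0 < s)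
    (hs : ∀ x, dimFunctional w (dimAut h φ x) = s * dimFunctional w x) :
    ENNReal.log (ENNReal.ofReal s) ≤ topEntropy φ.1 := by
  obtain ⟨N, hN⟩ := AutShift.exists_window φ
  obtain ⟨x⟩ := h.nonempty
  have hS : 0 < ∑ J, w J := Finset.sum_pos (fun J _ => hw.pos J) ⟨(x.1 0).tgt, Finset.mem_univ _⟩
  have hc := div_pos (hw.dimFunctional_thetaAt_ray_pos x 0) hS
  refine log_le_topEntropy_of_mul_pow_le_netMaxcard (window_mem_uniformity N)
    (ENNReal.ofReal_pos.2 hc).ne' fun n => ?_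
  calc _ = ENNReal.ofReal (s ^ n * dimFunctional w (thetaAt (ray x 0) 0) / ∑ J, w J) := by
        rw [← ENNReal.ofReal_pow hs0.le, ← ENNReal.ofReal_mul hc.le, mul_comm, mul_div_assoc]
    _ ≤ ENNReal.ofReal ((fun y => ray y 0) '' ((φ ^ n).1 '' ray x 0)).ncard :=
        ENNReal.ofReal_le_ofReal <| (div_le_iff₀ hS).2 <| hw.pow_mul_le_ncard_mul h hs0.ne' hs x n
    _ = ((((fun y => ray y 0) '' ((φ ^ n).1 '' ray x 0)).ncard : ℕ∞) : ENNReal) := by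
        rw [ENNReal.ofReal_natCast, ENat.toENNReal_coe]
    _ ≤ _ := ENat.toENNReal_mono (AutShift.ncard_image_ray_le_netMaxcard hN x n)

theorem eq_one_of_topEntropy_eq_zero (hw : IsPerronPair (realMatrix A) l w)
    (h : PosIrreducible A) {φ : AutShift A} {s : ℝ} (hs0 : 0 < s)
    (hs : ∀ x, dimFunctional w (dimAut h φ x) = s * dimFunctional w x)
    (hφ : topEntropy φ.1 = 0) : s = 1 := by
  have hle : ∀ {ψ : AutShift A} {t : ℝ}, 0 < t →
      (∀ x, dimFunctional w (dimAut h ψ x) = t * dimFunctional w x) →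
      topEntropy ψ.1 = 0 → t ≤ 1 := fun ht hψ hzero =>
    ENNReal.ofReal_le_one.1 <| ENNReal.log_le_zero_iff.1 <| hzero ▸ hw.log_le_topEntropy h ht hψ
  have hs_inv : ∀ x, dimFunctional w (dimAut h φ⁻¹ x) = s⁻¹ * dimFunctional w x := fun x => by
    simpa only [zpow_neg_one] using dimFunctional_dimAut_zpow h hs0.ne' hs (-1) x
  have hφ_inv : topEntropy (φ⁻¹).1 = 0 := (topEntropy_symm φ.1.toEquiv).trans hφ
  exact le_antisymm (hle hs0 hs hφ) ((inv_le_one₀ hs0).1 (hle (inv_pos.2 hs0) hs_inv hφ_inv))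

end IsPerronPair

end SFT

theorem corollary3p4 {k : ℕ} (A : Matrix (Fin k) (Fin k) ℕ)
    (hirr : (A.map (Nat.cast : ℕ → ℤ)).IsIrreducible)
    (hpos : 0 < SFT.topEntropy (SFT.shift A))
    (hdet : Irreducible
      (Matrix.det (1 - (Polynomial.X : Polynomial ℚ) • A.map (Nat.cast : ℕ → Polynomial ℚ))))
    (φ : SFT.AutShift A) (hφ : SFT.topEntropy φ.1 = 0) :
    SFT.IsInert ⟨hirr, hpos⟩ φ := by
  have h : SFT.PosIrreducible A := ⟨hirr, hpos⟩
  have : Nonempty (Fin k) := h.nonempty.map fun x => (x.1 0).src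
  have hdet' : Irreducible (SFT.ratMatrix A).charpolyRev := by
    have hmap : (SFT.ratMatrix A).map Polynomial.C = A.map (Nat.cast : ℕ → Polynomial ℚ) :=
      Matrix.ext fun i j => map_natCast Polynomial.C (A i j)
    rwa [Matrix.charpolyRev, hmap]
  obtain ⟨l, w, hw⟩ := SFT.exists_isPerronPair h.isIrreducible_realMatrix
  obtain ⟨s, hs0, hs⟩ := hw.exists_pos_dimFunctional_apply_eq_mul h.isIrreducible_realMatrix
    (SFT.dimAut_mem h φ)
  obtain rfl : s = 1 := hw.eq_one_of_topEntropy_eq_zero h hs0 hs hφ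
  refine MonoidHom.mem_ker.2 (Subtype.ext (LinearEquiv.ext fun x => ?_))
  exact hw.dimFunctional_injective hdet' ((hs x).trans (one_mul _))
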